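/- Let $F$ be a finite field with $q$ elements, let $G$ be a finite abelian group of order $m$, and let $FG$ be the group algebra of $G$ over $F$. Identify an element $(a_1,\dots,a_n)\in(FG)^n$ with the word of length $mn$ over $F$ formed by the coefficients of $a_1,\dots,a_n$, and let $\mathrm{w}$ denote the Hamming weight of this word. For an $FG$-submodule (quasi-abelian code) $C\subseteq(FG)^n$, $n \ge 1$, let $$\Delta(C)=\frac{\min\{\mathrm{w}(c): 0\neq c\in C\}}{mn}$$ be its relative distance (with $\Delta(0)=\infty$), and let $R(C)=\frac{\dim_F C}{mn}$ be its rate. For a $k\times n$ matrix $A$ over $FG$ put $C_A=\{\mathbf{b}A : \mathbf{b}\in(FG)^k\}$. Call $A$ full-rank if its rows are linearly independent over $FG$; equivalently, $R(C_A)=k/n$. For $x\in(0,1)$ let $$g_q(x)=1-x\log_q(q-1)+x\log_q x+(1-x)\log_q(1-x).$$ Let $0<r<1$ and $0<\delta<1-q^{-1}$, and for every $n$ let $k=k_n$ be an integer nearest to $rn$. Let $\mathcal F_n$ be the set of full-rank $k_n\times n$ matrices over $FG$ with the uniform distribution. Then $$\lim_{n\to\infty}\Pr_{A\in\mathcal F_n}\big(\Delta(C_A)>\delta\big)=\begin{cases}1,&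 r<g_q(\delta),\\ 0,& r>g_q(\delta),\end{cases}$$ and in both cases the convergence is exponential: if $\ell\in\{0,1\}$ is the limit, there are constants $c_1,c_2>0$ such that $\big|\Pr_{A\in\mathcal F_n}(\Delta(C_A)>\delta)-\ell\big|\le c_1e^{-c_2n}$ for all $n \ge 1$. -/

import Mathlib

open Filter Topology

noncomputable section

namespace QuasiAbelian

/-- The `q`-ary entropy `x log_q (q-1) - x log_q x - (1-x) log_q (1-x)`. Since `Real.logb b 0 = 0`,
the convention `0 log_q 0 = 0` is automatic. -/
def entropy (q : ℕ) (x : ℝ) : ℝ :=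
  x * Real.logb q ((q : ℝ) - 1) - x * Real.logb q x - (1 - x) * Real.logb q (1 - x)

/-- The `q`-ary asymptotic Gilbert-Varshamov bound `g_q = 1 - h_q`. -/
def gvBound (q : ℕ) (x : ℝ) : ℝ := 1 - entropy q x

section Code

variable {F G : Type*} [Field F] [CommGroup G]

/-- The Hamming weight of `a = (a_1, …, a_n) ∈ (FG)^n`, identified with the concatenated word of
length `|G| n` over `F`: the sum of the Hamming weights (numbers of non-zero coefficients)
of the `a_i`. -/
def weight {n : ℕ} (a : Fin n → MonoidAlgebra F G) : ℕ :=
  ∑ i, (a i).coeff.support.card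

/-- The minimum weight of a code: the least weight of a non-zero codeword
(`⊤` for the zero code, which has no non-zero codeword). -/
def minWeight {n : ℕ} (C : Submodule (MonoidAlgebra F G) (Fin n → MonoidAlgebra F G)) : ℕ∞ :=
  ⨅ c : {c // c ∈ C ∧ c ≠ 0}, (weight c.1 : ℕ∞)

/-- The relative distance `Δ(C) = w(C) / (|G| n)` (infinite for the zero code). -/
def relDistance {n : ℕ} (C : Submodule (MonoidAlgebra F G) (Fin n → MonoidAlgebra F G)) :
    ENNReal :=
  (minWeight C : ENNReal) / ((Nat.card G * n : ℕ) : ENNReal)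

/-- The rate `R(C) = dim_F C / (|G| n)`. -/
def rate {n : ℕ} (C : Submodule (MonoidAlgebra F G) (Fin n → MonoidAlgebra F G)) : ℝ :=
  (Module.finrank F C : ℝ) / (Nat.card G * n)

/-- The quasi-abelian code `C_A = {bA : b ∈ (FG)^k}` of index `n` generated by a `k × n` matrix
`A` over the group algebra `FG`. -/
def code {k n : ℕ} (A : Matrix (Fin k) (Fin n) (MonoidAlgebra F G)) :
    Submodule (MonoidAlgebra F G) (Fin n → MonoidAlgebra F G) :=
  LinearMap.range A.vecMulLinear

/-- A `k × n` matrix over `FG` is full-rank if its rows are linearly independent over `FG`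
(see `isFullRank_iff_rate` for the equivalence with `R(C_A) = k / n`). -/
def IsFullRank {k n : ℕ} (A : Matrix (Fin k) (Fin n) (MonoidAlgebra F G)) : Prop :=
  LinearIndependent (MonoidAlgebra F G) A.row

theorem isFullRank_iff_finrank [Finite G] {k n : ℕ}
    (A : Matrix (Fin k) (Fin n) (MonoidAlgebra F G)) :
    IsFullRank A ↔ Module.finrank F (code A) = Nat.card G * k := by
  have : Module.Finite F (MonoidAlgebra F G) :=
    Module.Finite.equiv (MonoidAlgebra.coeffLinearEquiv (M := G) (S := F) F).symm
  have hG : Module.finrank F (MonoidAlgebra F G) = Nat.card G := by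
    have := Fintype.ofFinite G
    rw [(MonoidAlgebra.coeffLinearEquiv (M := G) (S := F) F).finrank_eq,
      Module.finrank_finsupp_self, Nat.card_eq_fintype_card]
  have hd : Module.finrank F (Fin k → MonoidAlgebra F G) = Nat.card G * k := by
    rw [Module.finrank_pi_fintype]
    simp [hG, mul_comm]
  let f : (Fin k → MonoidAlgebra F G) →ₗ[F] (Fin n → MonoidAlgebra F G) :=
    A.vecMulLinear.restrictScalars F
  have hr : Module.finrank F (code A) = Module.finrank F (LinearMap.range f) := rfl
  have hk := f.finrank_range_add_finrank_ker
  have hi : IsFullRank A ↔ Function.Injective f := Matrix.vecMul_injective_iff.symm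
  rw [hi, ← LinearMap.ker_eq_bot, hr, ← hd, ← Submodule.finrank_eq_zero]
  omega

theorem isFullRank_iff_rate [Finite G] {k n : ℕ} (hn : 0 < n)
    (A : Matrix (Fin k) (Fin n) (MonoidAlgebra F G)) :
    IsFullRank A ↔ rate (code A) = (k : ℝ) / n := by
  have h1 : (Nat.card G : ℝ) ≠ 0 := by exact_mod_cast Nat.card_pos.ne'
  have h2 : (n : ℝ) ≠ 0 := by exact_mod_cast hn.ne'
  rw [isFullRank_iff_finrank, rate, div_eq_div_iff (by positivity) h2, ← Nat.cast_inj (R := ℝ)]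
  push_cast
  constructor
  · intro h
    rw [h]; ring
  · intro h
    apply mul_right_cancel₀ h2
    rw [h]; ring

end Code

/-- The probability of the event `Δ(C_A) > δ` when `A` is uniformly distributed on the full-rank
`k × n` matrices over `FG`. -/
def probFullRank (F G : Type*) [Field F] [CommGroup G] (k n : ℕ) (δ : ℝ) : ℝ :=
  (Nat.card {A : Matrix (Fin k) (Fin n) (MonoidAlgebra F G) //
      IsFullRank A ∧ ENNReal.ofReal δ < relDistance (code A)} : ℝ) /
    Nat.card {A : Matrix (Fin k) (Fin n) (MonoidAlgebra F G) // IsFullRank A}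

/-- `u n` converges to `l` exponentially fast as `n → ∞`. -/
def TendstoExponentially (u : ℕ → ℝ) (l : ℝ) : Prop :=
  Tendsto u atTop (𝓝 l) ∧
    ∃ C > 0, ∃ c > 0, ∀ n : ℕ, |u n - l| ≤ C * Real.exp (-c * n)

end QuasiAbelian

end

/-! Write R = FG, m = |G|, H for the entropy at δ and g = 1 - H, and call a word light if its
relative weight is at most δ. For uniform A and fixed b, the word bA is uniform on I^n, where I is
the ideal generated by the entries of b. At most |I|^k vectors b generate a given I, and the number
of ideals does not depend on n.

The key estimate is that every coset of I^n has at most m q^(H n dim I) light words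
(`ncard_coset_light_le`). Since I is G-stable, all translates of an information set T of I are
information sets, and they cover every coordinate equally often. Averaging yields a translate on
which a light word still has relative weight at most δ, and the Hamming ball bound in F^(n|T|)
applies.

Below the bound, summing over nonzero ideals gives an expected number of light bA, b ≠ 0, of order
at most q^(-n(g-r)), because dim I ≥ 1. The same union bound for the single word 0 shows that most
matrices have full rank, so conditioning on full rank costs at most a factor 2.

Above the bound, count the light words (1,b)A. Each is uniform on R^n, so the mean is about
q^(mn(r-g)). The words (1,b)A and (1,b+d)A are independent when the entries of d generate R;
otherwise d lies in a proper ideal, of dimension at most m-1. The excess factor V in the variance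
bound is therefore at most of order q^((m-1)n(r-g)), and Chebyshev bounds the probability of no
light word by V divided by the mean, about q^(-n(r-g)). The ball lower bound holds only for
exponents h < H, which costs part of this margin. -/

noncomputable section

namespace QuasiAbelian

/-! ### Weight enumerator of Hamming space. -/

section HammingBall

variable {ι F : Type*} [Fintype ι] [DecidableEq ι] [Fintype F] [Field F] [DecidableEq F]

/-- The weight enumerator of the full space `F^ι`. -/
theorem sum_pow_hammingNorm {S : Type*} [CommSemiring S] (z : S) :
    ∑ x : ι → F, z ^ hammingNorm x
      = (1 + ((Fintype.card F - 1 : ℕ) : S) * z) ^ Fintype.card ι := by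
  classical
  have h1 : ∀ x : ι → F, z ^ hammingNorm x = ∏ i, if x i = 0 then 1 else z := by
    intro x
    simp only [hammingNorm]
    rw [Finset.prod_ite]
    simp
  have h2 : ∑ a : F, (if a = 0 then (1 : S) else z)
      = 1 + ((Fintype.card F - 1 : ℕ) : S) * z := by
    rw [← Finset.add_sum_erase _ _ (Finset.mem_univ (0 : F)), if_pos rfl]
    congr 1
    rw [Finset.sum_congr rfl (g := fun _ => z)
      (fun a ha => if_neg (Finset.ne_of_mem_erase ha)), Finset.sum_const,
      Finset.card_erase_of_mem (Finset.mem_univ _), Finset.card_univ, nsmul_eq_mul]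
  simp_rw [h1]
  rw [← Fintype.prod_sum (fun (_ : ι) (a : F) => if a = 0 then (1 : S) else z)]
  simp [h2]

/-- Compare coefficients of X^j in the weight enumerator evaluated at the polynomial variable. -/
theorem card_hammingNorm_eq (j : ℕ) :
    (Finset.univ.filter fun x : ι → F => hammingNorm x = j).card
      = (Fintype.card ι).choose j * (Fintype.card F - 1) ^ j := by
  have h := congrArg (fun p : Polynomial ℕ => p.coeff j)
    (sum_pow_hammingNorm (ι := ι) (F := F) (Polynomial.X : Polynomial ℕ))
  simp only [Polynomial.finsetSum_coeff, Polynomial.coeff_X_pow] at h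
  rw [Finset.card_filter]
  simp_rw [eq_comm (b := j)]
  rw [h, add_comm, add_pow]
  simp only [one_pow, mul_one, mul_pow, Polynomial.finsetSum_coeff]
  have : ∀ i, ((((Fintype.card F - 1 : ℕ) : Polynomial ℕ) ^ i * Polynomial.X ^ i
      * (((Fintype.card ι).choose i : ℕ) : Polynomial ℕ)).coeff j)
      = if i = j then (Fintype.card ι).choose j * (Fintype.card F - 1) ^ j else 0 := by
    intro i
    rw [← Nat.cast_pow, mul_right_comm, ← Nat.cast_mul, ← Polynomial.C_eq_natCast,
      Polynomial.coeff_C_mul, Polynomial.coeff_X_pow]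
    by_cases hij : i = j
    · subst hij; simp [mul_comm]
    · simp [hij, Ne.symm hij]
  simp_rw [this]
  rw [Finset.sum_ite_eq']
  split_ifs with hj
  · rfl
  · rw [Nat.choose_eq_zero_of_lt (by simpa using hj), zero_mul]

end HammingBall

/-! ### Entropy bounds for Hamming balls. -/

section Entropy

variable {q : ℕ} {x : ℝ}

/-- The tilt z = x/((q-1)(1-x)) minimises (1+(q-1)z) z^(-x), and the minimum is q^(h_q(x)). In this
form entropy is tied to the weight enumerator at z, for both the upper and the lower ball bound. -/
theorem rpow_entropy (hq : 2 ≤ q) (h0 : 0 < x) (h1 : x < 1) :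
    (q : ℝ) ^ entropy q x
      = (1 + ((q : ℝ) - 1) * (x / (((q : ℝ) - 1) * (1 - x))))
        * (x / (((q : ℝ) - 1) * (1 - x))) ^ (-x) := by
  have hq' : (2 : ℝ) ≤ q := by exact_mod_cast hq
  have hq1 : 0 < (q : ℝ) - 1 := by linarith
  have hx : 0 < 1 - x := by linarith
  have hz : 0 < x / (((q : ℝ) - 1) * (1 - x)) := by positivity
  have e1 : 1 + ((q : ℝ) - 1) * (x / (((q : ℝ) - 1) * (1 - x))) = (1 - x)⁻¹ := by
    field_simp; ring
  rw [e1]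
  apply Real.log_injOn_pos (by simp only [Set.mem_Ioi]; positivity)
    (by simp only [Set.mem_Ioi]; positivity)
  rw [Real.log_rpow (by linarith), Real.log_mul (by positivity) (by positivity),
    Real.log_rpow hz, Real.log_inv, Real.log_div h0.ne' (by positivity),
    Real.log_mul hq1.ne' hx.ne', entropy]
  have : Real.log q ≠ 0 := (Real.log_pos (by linarith)).ne'
  simp only [Real.logb]
  field_simp
  ring

theorem continuousAt_entropy (h0 : 0 < x) (h1 : x < 1) : ContinuousAt (entropy q) x := by
  have h2 : (1 : ℝ) - x ≠ 0 := by linarith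
  unfold entropy
  simp only [Real.logb]
  have a := Real.continuousAt_log h0.ne'
  have b : ContinuousAt (fun y : ℝ => Real.log (1 - y)) x :=
    ContinuousAt.log (by fun_prop) h2
  fun_prop

/-- The tilt increases with x and reaches 1 at x = 1 - 1/q. Being at most 1 makes z^w decreasing in
the weight w. -/
theorem tilt_le_one (hq : 2 ≤ q) (h1 : x < 1 - (q : ℝ)⁻¹) :
    x / (((q : ℝ) - 1) * (1 - x)) ≤ 1 := by
  have hq' : (2 : ℝ) ≤ q := by exact_mod_cast hq
  have hq1 : 0 < (q : ℝ) - 1 := by linarith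
  have hi : 0 < (q : ℝ)⁻¹ := by positivity
  have hx : 0 < 1 - x := by linarith
  rw [div_le_one (by positivity)]
  have : (q : ℝ) * (1 - x) ≥ q * (q : ℝ)⁻¹ := by
    apply mul_le_mul_of_nonneg_left _ (by linarith); linarith
  rw [mul_inv_cancel₀ (by linarith)] at this
  linarith

/-- The Hamming ball of relative radius `x` in `F^ι` has at most `q^(h_q(x) |ι|)` elements. -/
theorem card_hammingBall_le {ι F : Type*} [Fintype ι] [DecidableEq ι] [Fintype F] [Field F] [DecidableEq F]
    (h0 : 0 < x) (h1 : x < 1 - (Fintype.card F : ℝ)⁻¹) :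
    ((Finset.univ.filter fun y : ι → F => (hammingNorm y : ℝ) ≤ x * Fintype.card ι).card : ℝ)
      ≤ (Fintype.card F : ℝ) ^ (entropy (Fintype.card F) x * Fintype.card ι) := by
  have hq : 2 ≤ Fintype.card F := Fintype.one_lt_card
  have hq' : (2 : ℝ) ≤ Fintype.card F := by exact_mod_cast hq
  have hi : 0 < (Fintype.card F : ℝ)⁻¹ := by positivity
  have hz1 := tilt_le_one hq h1
  have hz0 : 0 < x / (((Fintype.card F : ℝ) - 1) * (1 - x)) :=
    div_pos h0 (mul_pos (by linarith) (by linarith))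
  rw [Real.rpow_mul (by positivity), rpow_entropy hq h0 (by linarith)]
  set z := x / (((Fintype.card F : ℝ) - 1) * (1 - x)) with hz
  have hc : ((Fintype.card F - 1 : ℕ) : ℝ) = (Fintype.card F : ℝ) - 1 := by
    rw [Nat.cast_sub (by omega)]; simp
  have hsum := sum_pow_hammingNorm (ι := ι) (F := F) z
  rw [hc] at hsum
  rw [Real.rpow_natCast, mul_pow, ← hsum, ← Real.rpow_natCast (z ^ (-x)),
    ← Real.rpow_mul hz0.le, neg_mul, Real.rpow_neg hz0.le, ← div_eq_mul_inv,
    le_div_iff₀ (by positivity)]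
  -- Chernoff argument: as z ≤ 1, every word of the ball contributes at least z^(x|ι|) to the weight
  -- enumerator at z.
  calc _ = ∑ y ∈ Finset.univ.filter (fun y : ι → F => (hammingNorm y : ℝ) ≤ x * Fintype.card ι),
        z ^ (x * Fintype.card ι) := by simp
    _ ≤ ∑ y ∈ Finset.univ.filter (fun y : ι → F => (hammingNorm y : ℝ) ≤ x * Fintype.card ι),
        z ^ hammingNorm y := by
      apply Finset.sum_le_sum
      intro y hy
      rw [← Real.rpow_natCast]
      exact Real.rpow_le_rpow_of_exponent_ge hz0 hz1 (Finset.mem_filter.1 hy).2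
    _ ≤ _ := Finset.sum_le_sum_of_subset_of_nonneg (Finset.filter_subset _ _)
        fun _ _ _ => by positivity

/-- The largest term of the binomial expansion of `(1 + w)^N` with `w = p / (1 - p)`
sits at an index within `1` of `N p`. -/
theorem exists_choose_mul_pow_max {p : ℝ} (h0 : 0 < p) (h1 : p < 1) (N : ℕ) :
    ∃ j : ℕ, (j : ℝ) ≤ N * p + 1 ∧ N * p - 1 ≤ j ∧
      (1 + p / (1 - p)) ^ N ≤ (N + 1) * ((N.choose j : ℝ) * (p / (1 - p)) ^ j) := by
  set w := p / (1 - p) with hw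
  have hp : 0 < 1 - p := by linarith
  have hw0 : 0 < w := by positivity
  have hwp : w * (1 - p) = p := by rw [hw]; field_simp
  obtain ⟨j, hj, hmax⟩ := Finset.exists_max_image (Finset.range (N + 1))
    (fun j => (N.choose j : ℝ) * w ^ j) ⟨0, by simp⟩
  have hjN : j ≤ N := by simpa [Nat.lt_succ_iff] using hj
  have hmax' : ∀ i, (N.choose i : ℝ) * w ^ i ≤ (N.choose j : ℝ) * w ^ j := by
    intro i
    by_cases hi : i ∈ Finset.range (N + 1)
    · exact hmax i hi
    · rw [Nat.choose_eq_zero_of_lt (by simpa using hi)]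
      simp only [Nat.cast_zero, zero_mul]; positivity
  -- This gives the ratio of consecutive terms; comparing the maximal term with each neighbour
  -- confines its index.
  have key : ∀ i, i ≤ N → (N.choose (i + 1) : ℝ) * (i + 1) = N.choose i * ((N : ℝ) - i) := by
    intro i hi
    have := Nat.choose_succ_right_eq N i
    rw [← Nat.cast_sub hi]
    exact_mod_cast this
  have hpos : ∀ i, i ≤ N → (0 : ℝ) < (N.choose i : ℝ) * w ^ i := fun i hi => by
    have : (0 : ℝ) < N.choose i := by exact_mod_cast Nat.choose_pos hi
    positivity
  refine ⟨j, ?_, ?_, ?_⟩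
  · rcases j with _ | i
    · simp only [Nat.cast_zero]; positivity
    · have hiN : i ≤ N := by omega
      have hm := hmax' i
      have hk := key i hiN
      have hP := hpos i hiN
      have : (N.choose i : ℝ) * w ^ i * (i + 1) ≤ (N.choose i : ℝ) * w ^ i * ((N - i) * w) := by
        calc _ ≤ (N.choose (i + 1) : ℝ) * w ^ (i + 1) * (i + 1) := by gcongr
          _ = ((N.choose (i + 1) : ℝ) * (i + 1)) * w ^ (i + 1) := by ring
          _ = _ := by rw [hk]; ring
      have h3 := le_of_mul_le_mul_left this hP
      have h4 : ((i : ℝ) + 1) * (1 - p) ≤ (N - i) * p := by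
        calc _ ≤ ((N - i) * w) * (1 - p) := by gcongr
          _ = (N - i) * (w * (1 - p)) := by ring
          _ = _ := by rw [hwp]
      push_cast
      linarith
  · have hm := hmax' (j + 1)
    have hk := key j hjN
    have hP := hpos j hjN
    have : (N.choose j : ℝ) * w ^ j * ((N - j) * w) ≤ (N.choose j : ℝ) * w ^ j * (j + 1) := by
      calc _ = ((N.choose j : ℝ) * (N - j)) * w ^ (j + 1) := by ring
        _ = (N.choose (j + 1) : ℝ) * w ^ (j + 1) * (j + 1) := by rw [← hk]; ring
        _ ≤ _ := by gcongr
    have h3 := le_of_mul_le_mul_left this hP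
    have h4 : ((N : ℝ) - j) * p ≤ (j + 1) * (1 - p) := by
      calc _ = (N - j) * (w * (1 - p)) := by rw [hwp]
        _ = ((N - j) * w) * (1 - p) := by ring
        _ ≤ _ := by gcongr
    linarith
  · rw [add_comm, add_pow]
    calc _ ≤ ∑ _i ∈ Finset.range (N + 1), (N.choose j : ℝ) * w ^ j := by
          apply Finset.sum_le_sum
          intro i _
          simpa [mul_comm] using hmax' i
      _ = _ := by simp

/-- One sphere suffices: the largest of the N+1 terms of the enumerator at the tilt of some p < x
carries the sum up to a factor N+1, which an arbitrarily small loss in the exponent absorbs. -/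
theorem eventually_rpow_le_choose (hq : 2 ≤ q) (h0 : 0 < x) (h1 : x < 1 - (q : ℝ)⁻¹)
    {h : ℝ} (hh : h < entropy q x) :
    ∀ᶠ N : ℕ in atTop, ∃ j : ℕ, (j : ℝ) ≤ x * N ∧
      (q : ℝ) ^ (h * N) ≤ (N.choose j : ℝ) * ((q : ℝ) - 1) ^ j := by
  have hq' : (2 : ℝ) ≤ q := by exact_mod_cast hq
  have hq1 : 0 < (q : ℝ) - 1 := by linarith
  have hi : 0 < (q : ℝ)⁻¹ := by positivity
  have hev : ∀ᶠ p in 𝓝[<] x, h < entropy q p ∧ 0 < p ∧ p < x := by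
    refine ((continuousAt_entropy h0 (by linarith)).eventually_const_lt hh |>.filter_mono
      nhdsWithin_le_nhds).and (((eventually_gt_nhds h0).filter_mono nhdsWithin_le_nhds).and
      self_mem_nhdsWithin)
  -- Taking p strictly below x leaves room for the error 1 in the index: Np + 1 ≤ xN for large N.
  obtain ⟨p, hp, hp0, hpx⟩ := hev.exists
  have hp1 : 0 < 1 - p := by linarith
  set z := p / (((q : ℝ) - 1) * (1 - p)) with hz
  have hz0 : 0 < z := by positivity
  have hz1 : z ≤ 1 := tilt_le_one hq (by linarith)
  have hqz : ((q : ℝ) - 1) * z = p / (1 - p) := by rw [hz]; field_simp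
  have hlim : Tendsto (fun N : ℕ => ((N : ℝ) + 1) * ((q : ℝ) ^ (h - entropy q p)) ^ N)
      atTop (𝓝 0) := by
    have hr0 : 0 ≤ (q : ℝ) ^ (h - entropy q p) := by positivity
    have hr1 : (q : ℝ) ^ (h - entropy q p) < 1 :=
      Real.rpow_lt_one_of_one_lt_of_neg (by linarith) (by linarith)
    have := (tendsto_self_mul_const_pow_of_lt_one hr0 hr1).add
      (tendsto_pow_atTop_nhds_zero_of_lt_one hr0 hr1)
    simpa [add_mul] using this
  filter_upwards [hlim.eventually_le_const hz0,
    tendsto_natCast_atTop_atTop.eventually_ge_atTop (1 / (x - p))] with N hN1 hN2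
  obtain ⟨j, hj1, hj2, hj3⟩ := exists_choose_mul_pow_max hp0 (by linarith : p < 1) N
  refine ⟨j, ?_, ?_⟩
  · rw [div_le_iff₀ (by linarith)] at hN2
    nlinarith
  · rw [← hqz, mul_pow] at hj3
    have hNpos : (0 : ℝ) < N + 1 := by positivity
    set T := (N.choose j : ℝ) * ((q : ℝ) - 1) ^ j with hT
    have hT0 : 0 ≤ T := by positivity
    have e1 : (q : ℝ) ^ (entropy q p * N) ≤ (N + 1) * T * z⁻¹ := by
      rw [Real.rpow_mul (by positivity), rpow_entropy hq hp0 (by linarith), ← hz,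
        Real.rpow_natCast, mul_pow, ← Real.rpow_natCast (z ^ (-p)), ← Real.rpow_mul hz0.le]
      calc _ ≤ ((N + 1) * (T * z ^ j)) * z ^ (-p * N) := by
            gcongr
            rw [hT]; linarith
        _ = (N + 1) * T * (z ^ ((j : ℝ) + -p * N)) := by
            rw [Real.rpow_add hz0, Real.rpow_natCast]; ring
        -- The index satisfies j - pN ≥ -1, and z ≤ 1.
        _ ≤ (N + 1) * T * (z ^ (-1 : ℝ)) := by
            gcongr ?_ * ?_
            exact Real.rpow_le_rpow_of_exponent_ge hz0 hz1 (by linarith)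
        _ = _ := by rw [Real.rpow_neg_one]
    have e2 : (q : ℝ) ^ (h * N) = ((q : ℝ) ^ (h - entropy q p)) ^ N * q ^ (entropy q p * N) := by
      rw [← Real.rpow_natCast, ← Real.rpow_mul (by positivity), ← Real.rpow_add (by positivity)]
      congr 1; ring
    rw [e2]
    calc _ ≤ ((q : ℝ) ^ (h - entropy q p)) ^ N * ((N + 1) * T * z⁻¹) := by gcongr
      _ = ((N + 1) * ((q : ℝ) ^ (h - entropy q p)) ^ N) * (T * z⁻¹) := by ring
      _ ≤ z * (T * z⁻¹) := by gcongr
      _ = T := by field_simp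

/-- For every `h < h_q(x)`, large Hamming balls of relative radius `x` have at least `q^(h N)`
elements. -/
theorem eventually_le_card_hammingBall {F : Type*} [Fintype F] [Field F] [DecidableEq F]
    (h0 : 0 < x) (h1 : x < 1 - (Fintype.card F : ℝ)⁻¹) {h : ℝ}
    (hh : h < entropy (Fintype.card F) x) :
    ∀ᶠ N : ℕ in atTop, ∀ (ι : Type*) [Fintype ι] [DecidableEq ι], Fintype.card ι = N →
      (Fintype.card F : ℝ) ^ (h * N) ≤
        (Finset.univ.filter fun y : ι → F => (hammingNorm y : ℝ) ≤ x * N).card := by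
  have hq : 2 ≤ Fintype.card F := Fintype.one_lt_card
  filter_upwards [eventually_rpow_le_choose hq h0 h1 hh] with N hN ι _ _ hι
  obtain ⟨j, hj, hle⟩ := hN
  refine hle.trans ?_
  have hc : ((Fintype.card F - 1 : ℕ) : ℝ) = (Fintype.card F : ℝ) - 1 := by
    rw [Nat.cast_sub (by omega)]; simp
  rw [← hc, ← hι]
  have := card_hammingNorm_eq (ι := ι) (F := F) j
  rw [← Nat.cast_pow, ← Nat.cast_mul, ← this, Nat.cast_le]
  apply Finset.card_le_card
  intro y hy
  simp only [Finset.mem_filter, Finset.mem_univ, true_and] at hy ⊢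
  rw [hy, hι]; exact hj

end Entropy

/-! ### Information sets and light words in the group algebra. -/

/-- A finite separating family of linear forms on a finite-dimensional space contains a separating
subfamily with exactly `dim V` members. -/
theorem exists_finset_separating {K V ι : Type*} [Field K] [AddCommGroup V] [Module K V]
    [Module.Finite K V] [Finite ι] (f : ι → V →ₗ[K] K) (hf : ∀ x, (∀ i, f i x = 0) → x = 0) :
    ∃ T : Finset ι, T.card = Module.finrank K V ∧ ∀ x, (∀ i ∈ T, f i x = 0) → x = 0 := by
  classical
  have := Fintype.ofFinite ι
  -- By duality, a separating family spans the dual space; a basis extracted from it still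
  -- separates.
  have htop : Submodule.span K (Set.range f) = ⊤ := by
    apply Submodule.span_eq_top_of_ne_zero
    intro z hz
    by_contra! h
    exact hz (hf z fun i => h (f i) ⟨i, rfl⟩)
  obtain ⟨κ, a, ha, hsp, hli⟩ := exists_linearIndependent' K f
  have : Finite κ := Finite.of_injective a ha
  have := Fintype.ofFinite κ
  rw [htop] at hsp
  refine ⟨Finset.univ.image a, ?_, ?_⟩
  · rw [Finset.card_image_of_injective _ ha, Finset.card_univ]
    have hb := Module.finrank_eq_card_basis (Module.Basis.mk hli hsp.ge)
    rw [← hb]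
    exact Subspace.dual_finrank_eq
  · intro x hx
    rw [← Module.forall_dual_apply_eq_zero_iff K]
    intro φ
    have hφ : φ ∈ Submodule.span K (Set.range (f ∘ a)) := hsp ▸ Submodule.mem_top
    induction hφ using Submodule.span_induction with
    | mem y hy =>
      obtain ⟨t, rfl⟩ := hy
      exact hx _ (Finset.mem_image_of_mem _ (Finset.mem_univ _))
    | zero => simp
    | add y z _ _ hy hz => simp [hy, hz]
    | smul c y _ hy => simp [hy]

section GroupAlgebra

variable {F G : Type*} [Field F]

theorem moduleFinite_monoidAlgebra [Finite G] : Module.Finite F (MonoidAlgebra F G) :=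
  Module.Finite.equiv (MonoidAlgebra.coeffLinearEquiv (M := G) (S := F) F).symm

theorem finite_monoidAlgebra [Finite F] [Finite G] : Finite (MonoidAlgebra F G) :=
  have := moduleFinite_monoidAlgebra (F := F) (G := G)
  Module.finite_of_finite F

theorem finrank_monoidAlgebra [Finite G] :
    Module.finrank F (MonoidAlgebra F G) = Nat.card G := by
  have := Fintype.ofFinite G
  rw [(MonoidAlgebra.coeffLinearEquiv (M := G) (S := F) F).finrank_eq,
    Module.finrank_finsupp_self, Nat.card_eq_fintype_card]

theorem card_monoidAlgebra [Finite G] :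
    Nat.card (MonoidAlgebra F G) = Nat.card F ^ Nat.card G := by
  have := moduleFinite_monoidAlgebra (F := F) (G := G)
  rw [Module.natCard_eq_pow_finrank (K := F), finrank_monoidAlgebra]

variable [CommGroup G]

theorem card_ideal [Finite G] (I : Ideal (MonoidAlgebra F G)) :
    Nat.card I = Nat.card F ^ Module.finrank F I := by
  have := moduleFinite_monoidAlgebra (F := F) (G := G)
  have : Module.Finite F I :=
    inferInstanceAs (Module.Finite F (I.restrictScalars F))
  exact Module.natCard_eq_pow_finrank

/-- This makes every nonzero ideal contribute exponential decay to the union bound. -/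
theorem one_le_finrank_ideal [Finite G] {I : Ideal (MonoidAlgebra F G)}
    (hI : I ≠ ⊥) : 1 ≤ Module.finrank F I := by
  have := moduleFinite_monoidAlgebra (F := F) (G := G)
  have h : I.restrictScalars F ≠ ⊥ := by simpa using hI
  exact Submodule.one_le_finrank_iff.2 h

/-- The missing dimension is the whole gain in the Chebyshev quotient. -/
theorem finrank_ideal_lt [Finite G] {I : Ideal (MonoidAlgebra F G)}
    (hI : I ≠ ⊤) : Module.finrank F I < Nat.card G := by
  have := moduleFinite_monoidAlgebra (F := F) (G := G)
  have h : I.restrictScalars F ≠ ⊤ := by simpa using hI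
  rw [← finrank_monoidAlgebra (F := F) (G := G)]
  exact Submodule.finrank_lt h

/-- An ideal of `FG` has an information set with `dim I` elements, and so are all
its translates. -/
theorem exists_informationSet [Finite G] (I : Ideal (MonoidAlgebra F G)) :
    ∃ T : Finset G, T.card = Module.finrank F I ∧
      ∀ g : G, ∀ x ∈ I, (∀ t ∈ T, x.coeff (g * t) = 0) → x = 0 := by
  have := moduleFinite_monoidAlgebra (F := F) (G := G)
  have : Module.Finite F I :=
    inferInstanceAs (Module.Finite F (I.restrictScalars F))
  let f : G → I →ₗ[F] F := fun g =>
    (Finsupp.lapply g ∘ₗ (MonoidAlgebra.coeffLinearEquiv (M := G) (S := F) F).toLinearMap) ∘ₗ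
      I.subtype.restrictScalars F
  have hf : ∀ g x, f g x = (x : MonoidAlgebra F G).coeff g := fun _ _ => rfl
  obtain ⟨T, hT, h⟩ := exists_finset_separating f (by
    intro x hx
    ext g
    exact hx g)
  refine ⟨T, hT, fun g x hx hxT => ?_⟩
  -- Multiplication by g⁻¹ preserves I and carries the coordinates g * t to t, so one information
  -- set yields all its translates.
  have hmem : MonoidAlgebra.single g⁻¹ (1 : F) * x ∈ I := I.mul_mem_left _ hx
  have hz := h ⟨_, hmem⟩ (by
    intro t ht
    rw [hf]
    have := MonoidAlgebra.coeff_single_mul_mul x (1 : F) g⁻¹ (g * t)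
    rw [inv_mul_cancel_left] at this
    rw [this, hxT t ht, mul_zero])
  have hz' : MonoidAlgebra.single g⁻¹ (1 : F) * x = 0 := congrArg Subtype.val hz
  have := congrArg (fun y => MonoidAlgebra.single g (1 : F) * y) hz'
  simpa [← mul_assoc, MonoidAlgebra.single_mul_single, ← MonoidAlgebra.one_def] using this

/-- A coset of `I^n` contains at most `m q^(h_q(δ) n dim I)` words of relative weight `≤ δ`. -/
theorem ncard_coset_light_le [Finite F] [Finite G] {δ : ℝ} (h0 : 0 < δ)
    (h1 : δ < 1 - (Nat.card F : ℝ)⁻¹) {n : ℕ} (I : Ideal (MonoidAlgebra F G))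
    (v : Fin n → MonoidAlgebra F G) :
    ({u : Fin n → MonoidAlgebra F G | (∀ j, u j - v j ∈ I) ∧
        (weight u : ℝ) ≤ δ * (Nat.card G * n : ℕ)}.ncard : ℝ)
      ≤ Nat.card G *
        (Nat.card F : ℝ) ^ (entropy (Nat.card F) δ * (n * Module.finrank F I : ℕ)) := by
  classical
  have := Fintype.ofFinite F
  have := Fintype.ofFinite G
  have := finite_monoidAlgebra (F := F) (G := G)
  simp only [Nat.card_eq_fintype_card] at *
  obtain ⟨T, hT, hsep⟩ := exists_informationSet I
  have hcard : Fintype.card (Fin n × T) = n * Module.finrank F I := by simp [hT]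
  let y : G → (Fin n → MonoidAlgebra F G) → (Fin n × T → F) :=
    fun g u p => (u p.1).coeff (g * p.2)
  set B := Finset.univ.filter fun z : Fin n × T → F =>
    (hammingNorm z : ℝ) ≤ δ * Fintype.card (Fin n × T) with hB
  let S : G → Set (Fin n → MonoidAlgebra F G) := fun g =>
    {u | (∀ j, u j - v j ∈ I) ∧ y g u ∈ B}
  have hS : ∀ g, (S g).ncard ≤ B.card := by
    intro g
    rw [← Set.ncard_coe_finset]
    apply Set.ncard_le_ncard_of_injOn (y g) (fun u hu => hu.2)
    intro u hu u' hu' he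
    funext j
    have hm : u j - u' j ∈ I := by simpa using I.sub_mem (hu.1 j) (hu'.1 j)
    refine sub_eq_zero.1 (hsep g _ hm fun t ht => ?_)
    have := congrFun he (j, ⟨t, ht⟩)
    simpa [sub_eq_zero, y] using this
  -- Double counting: for fixed t, the products g * t run once through G, so each coordinate is seen
  -- |T| times.
  have hsum : ∀ u, ∑ g, hammingNorm (y g u) = T.card * weight u := by
    intro u
    simp only [hammingNorm, y, Finset.card_filter, Fintype.sum_prod_type]
    rw [Finset.sum_comm, weight, Finset.mul_sum]
    refine Finset.sum_congr rfl fun j _ => ?_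
    rw [Finset.sum_comm]
    have : ∀ t : T, (∑ g : G, if (u j).coeff (g * t) ≠ 0 then 1 else 0)
        = (u j).coeff.support.card := by
      intro t
      have e := Equiv.sum_comp (Equiv.mulRight (t : G))
        (fun g => if (u j).coeff g ≠ 0 then 1 else 0)
      simp only [Equiv.coe_mulRight] at e
      trans ∑ g : G, if (u j).coeff g ≠ 0 then 1 else 0
      · exact e
      · rw [← Finset.card_filter]
        congr 1
        ext g
        simp
    rw [Finset.sum_congr rfl fun t _ => this t, Finset.sum_const, Finset.card_univ,
      Fintype.card_coe, smul_eq_mul]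
  have hsub : {u : Fin n → MonoidAlgebra F G | (∀ j, u j - v j ∈ I) ∧
      (weight u : ℝ) ≤ δ * (Fintype.card G * n : ℕ)} ⊆ ⋃ g, S g := by
    -- If every translate saw relative weight above δ, summing over g would contradict the lightness
    -- of u.
    rintro u ⟨hu1, hu2⟩
    by_contra hcon
    have hlt : ∀ g, δ * Fintype.card (Fin n × T) < hammingNorm (y g u) := by
      intro g
      by_contra hle
      exact hcon (Set.mem_iUnion.2 ⟨g, hu1, by simpa [hB] using hle⟩)
    have h2 : ∑ _g : G, δ * Fintype.card (Fin n × T) < ∑ g, (hammingNorm (y g u) : ℝ) :=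
      Finset.sum_lt_sum_of_nonempty Finset.univ_nonempty fun g _ => hlt g
    rw [← Nat.cast_sum, hsum, Finset.sum_const, Finset.card_univ, nsmul_eq_mul, hcard, ← hT] at h2
    push_cast at h2 hu2
    nlinarith [mul_le_mul_of_nonneg_left hu2 (Nat.cast_nonneg (α := ℝ) T.card)]
  have hfin := (Set.ncard_le_ncard hsub (Set.toFinite _)).trans
    ((Set.ncard_iUnion_le_of_fintype S).trans (Finset.sum_le_sum fun g _ => hS g))
  rw [Finset.sum_const, Finset.card_univ, smul_eq_mul] at hfin
  have hb := card_hammingBall_le (ι := Fin n × T) (F := F) h0 h1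
  rw [← hcard]
  calc _ ≤ ((Fintype.card G * B.card : ℕ) : ℝ) := by exact_mod_cast hfin
    _ ≤ _ := by
      push_cast
      gcongr

/-- For `h < h_q(δ)` and large `n`, at least `q^(h m n)` words of `(FG)^n` have relative
weight `≤ δ`. -/
theorem eventually_le_ncard_light [Finite F] [Finite G] {δ h : ℝ} (h0 : 0 < δ)
    (h1 : δ < 1 - (Nat.card F : ℝ)⁻¹) (hh : h < entropy (Nat.card F) δ) :
    ∀ᶠ n : ℕ in atTop, (Nat.card F : ℝ) ^ (h * (Nat.card G * n : ℕ)) ≤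
      {u : Fin n → MonoidAlgebra F G | (weight u : ℝ) ≤ δ * (Nat.card G * n : ℕ)}.ncard := by
  classical
  have := Fintype.ofFinite F
  have := Fintype.ofFinite G
  have := finite_monoidAlgebra (F := F) (G := G)
  simp only [Nat.card_eq_fintype_card] at *
  have htend : Tendsto (fun n : ℕ => Fintype.card G * n) atTop atTop :=
    tendsto_id.const_mul_atTop' Fintype.card_pos
  filter_upwards [htend.eventually (eventually_le_card_hammingBall h0 h1 hh)] with n hn
  refine (hn (Fin n × G) (by simp [mul_comm])).trans ?_
  rw [Nat.cast_le, ← Set.ncard_coe_finset]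
  let e : (Fin n × G → F) → (Fin n → MonoidAlgebra F G) := fun z j =>
    MonoidAlgebra.ofCoeff (Finsupp.equivFunOnFinite.symm fun g => z (j, g))
  apply Set.ncard_le_ncard_of_injOn e _ _ (Set.toFinite _)
  · intro z hz
    simp only [Finset.coe_filter, Finset.mem_univ, true_and, Set.mem_ofPred_eq] at hz ⊢
    refine le_of_eq_of_le ?_ hz
    congr 1
    simp only [weight, hammingNorm, Finset.card_filter, Fintype.sum_prod_type]
    refine Finset.sum_congr rfl fun j _ => ?_
    rw [← Finset.card_filter]
    congr 1
    ext g
    simp [e]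
  · intro z _ z' _ hzz
    funext p
    have := congrArg (fun x : MonoidAlgebra F G => x.coeff p.2) (congrFun hzz p.1)
    simpa [e] using this

end GroupAlgebra

/-! ### Uniform fibres and Chebyshev's inequality. -/

theorem ncard_eq_sum_indicator {α : Type*} [Fintype α] (s : Set α) [DecidablePred (· ∈ s)] :
    (s.ncard : ℝ) = ∑ x, if x ∈ s then (1 : ℝ) else 0 := by
  rw [Finset.sum_boole, Nat.cast_inj, Set.ncard_eq_toFinset_card']
  congr 1
  ext x
  simp

/-- The image of the uniform distribution under a surjective homomorphism is uniform. -/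
theorem ncard_preimage_mul_card {M N : Type*} [AddGroup M] [AddGroup N] [Finite M]
    (φ : M →+ N) (hφ : Function.Surjective φ) (S : Set N) :
    (φ ⁻¹' S).ncard * Nat.card N = Nat.card M * S.ncard := by
  classical
  have : Finite N := Finite.of_surjective φ hφ
  have := Fintype.ofFinite M
  have := Fintype.ofFinite N
  set c := (Finset.univ.filter fun x => φ x = 0).card with hc
  have hfib : ∀ y, (Finset.univ.filter fun x => φ x = y).card = c := fun y =>
    AddMonoidHom.card_fiber_eq_of_mem_range φ (hφ y) (hφ 0)
  have h : ∀ S : Set N, (φ ⁻¹' S).ncard = S.ncard * c := by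
    intro S
    rw [Set.ncard_eq_toFinset_card', Set.ncard_eq_toFinset_card',
      Finset.card_eq_sum_card_fiberwise (f := φ) (t := S.toFinset) (by intro x; simp)]
    rw [Finset.sum_congr rfl (g := fun _ => c), Finset.sum_const, smul_eq_mul]
    intro y hy
    rw [← hfib y]
    congr 1
    ext x
    simp only [Set.mem_toFinset] at hy
    simp only [Finset.mem_filter, Set.mem_preimage, Set.mem_toFinset,
      Finset.mem_univ, true_and, and_iff_right_iff_imp]
    rintro rfl
    exact hy
  have h1 := h Set.univ
  rw [Set.preimage_univ, Set.ncard_univ, Set.ncard_univ] at h1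
  rw [h S, h1]
  ring

/-- Chebyshev's inequality at `0` on a finite set, for a function with mean `μ` and variance at
most `μ V`. -/
theorem ncard_eq_zero_mul_le {Ω : Type*} [Fintype Ω] (X : Ω → ℝ) {μ V : ℝ} (hμ : 0 ≤ μ)
    (hV : 0 ≤ V) (h1 : ∑ x, X x = Fintype.card Ω * μ)
    (h2 : ∑ x, X x ^ 2 ≤ Fintype.card Ω * (μ ^ 2 + μ * V)) :
    ({x | X x = 0}.ncard : ℝ) * μ ≤ Fintype.card Ω * V := by
  classical
  have hvar : ∑ x, (X x - μ) ^ 2 = ∑ x, X x ^ 2 - 2 * μ * ∑ x, X x + Fintype.card Ω * μ ^ 2 := by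
    simp only [sub_sq, Finset.sum_add_distrib, Finset.sum_sub_distrib, Finset.sum_const,
      Finset.card_univ, nsmul_eq_mul, Finset.mul_sum]
    congr 2
    exact Finset.sum_congr rfl fun x _ => by ring
  have hcheb : ({x | X x = 0}.ncard : ℝ) * μ ^ 2 ≤ ∑ x, (X x - μ) ^ 2 := by
    rw [ncard_eq_sum_indicator, Finset.sum_mul]
    refine Finset.sum_le_sum fun x _ => ?_
    split_ifs with hx
    · rw [Set.mem_ofPred_eq] at hx
      rw [hx]; simp
    · simp only [zero_mul]; positivity
  rcases hμ.eq_or_lt with h0 | h0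
  · rw [← h0, mul_zero]; positivity
  · refine le_of_mul_le_mul_right ?_ h0
    rw [hvar, h1] at hcheb
    linarith

/-! ### First and second moments over a finite commutative ring. -/

section Ring

variable {R : Type*} [CommRing R] {k n : ℕ}

theorem vecMul_mem_span (b : Fin k → R) (A : Matrix (Fin k) (Fin n) R) (j : Fin n) :
    Matrix.vecMul b A j ∈ Ideal.span (Set.range b) := by
  simp only [Matrix.vecMul, dotProduct]
  exact Ideal.sum_mem _ fun i _ =>
    Ideal.mul_mem_right _ _ (Ideal.subset_span ⟨i, rfl⟩)

/-- `A ↦ b A`, as a map onto the vectors with entries in the ideal generated by `b`. -/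
def vecMulHom (n : ℕ) (b : Fin k → R) :
    Matrix (Fin k) (Fin n) R →+ (Fin n → Ideal.span (Set.range b)) where
  toFun A j := ⟨Matrix.vecMul b A j, vecMul_mem_span b A j⟩
  map_zero' := by
    ext j
    simp
  map_add' A B := by
    ext j
    simp [Matrix.vecMul_add]

theorem vecMulHom_surjective (b : Fin k → R) : Function.Surjective (vecMulHom n b) := by
  intro v
  have h : ∀ j, ∃ c : Fin k → R, ∑ i, c i * b i = v j := fun j =>
    Ideal.mem_span_range_iff_exists_fun.1 (v j).2
  choose c hc using h
  refine ⟨Matrix.of fun i j => c j i, ?_⟩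
  ext j
  simp only [vecMulHom, Matrix.vecMul, dotProduct, AddMonoidHom.coe_mk, ZeroHom.coe_mk,
    Matrix.of_apply]
  rw [← hc j]
  exact Finset.sum_congr rfl fun i _ => mul_comm _ _

variable [Finite R]

/-- For uniform `A`, the word `b A` is uniform on the vectors with entries in the ideal
generated by `b`. -/
theorem ncard_vecMul_mem (b : Fin k → R) (S : Set (Fin n → R)) :
    {A : Matrix (Fin k) (Fin n) R | Matrix.vecMul b A ∈ S}.ncard
        * Nat.card (Ideal.span (Set.range b)) ^ n
      = Nat.card (Matrix (Fin k) (Fin n) R)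
        * {u : Fin n → R | (∀ j, u j ∈ Ideal.span (Set.range b)) ∧ u ∈ S}.ncard := by
  set I := Ideal.span (Set.range b) with hI
  have h := ncard_preimage_mul_card (vecMulHom n b) (vecMulHom_surjective b)
    {v | (fun j => (v j : R)) ∈ S}
  rw [Nat.card_fun, Nat.card_fin] at h
  have hinj : Function.Injective (fun (v : Fin n → I) (j : Fin n) => (v j : R)) := by
    intro v v' hv
    funext j
    exact Subtype.ext (congrFun hv j)
  have himg : {u : Fin n → R | (∀ j, u j ∈ I) ∧ u ∈ S}
      = (fun (v : Fin n → I) (j : Fin n) => (v j : R)) ''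
        {v : Fin n → I | (fun j => (v j : R)) ∈ S} := by
    ext u
    constructor
    · rintro ⟨h1, h2⟩
      exact ⟨fun j => ⟨u j, h1 j⟩, h2, rfl⟩
    · rintro ⟨v, hv, rfl⟩
      exact ⟨fun j => (v j).2, hv⟩
  rw [himg, Set.ncard_image_of_injective _ hinj]
  exact h

/-- If `e` has first coordinate `1` and `d` has first coordinate `0`, then for uniform `A` the pair
`(e A, d A)` is uniform on `R^n × I^n`, where `I` is the ideal generated by `d`. -/
theorem ncard_vecMul_pair_mem (e d : Fin (k + 1) → R) (he : e 0 = 1) (hd : d 0 = 0)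
    (S : Set (Fin n → R)) :
    {A : Matrix (Fin (k + 1)) (Fin n) R |
        Matrix.vecMul e A ∈ S ∧ Matrix.vecMul (e + d) A ∈ S}.ncard
        * (Nat.card R ^ n * Nat.card (Ideal.span (Set.range d)) ^ n)
      = Nat.card (Matrix (Fin (k + 1)) (Fin n) R)
        * {p : (Fin n → R) × (Fin n → R) |
            p.1 ∈ S ∧ p.2 ∈ S ∧ ∀ j, p.2 j - p.1 j ∈ Ideal.span (Set.range d)}.ncard := by
  set I := Ideal.span (Set.range d) with hI
  let φ : Matrix (Fin (k + 1)) (Fin n) R →+ (Fin n → R) × (Fin n → I) :=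
    AddMonoidHom.prod ((Matrix.vecMulBilin R R e).toAddMonoidHom) (vecMulHom n d)
  have hφ1 : ∀ A, (φ A).1 = Matrix.vecMul e A := fun A => rfl
  have hφ2 : ∀ A j, ((φ A).2 j : R) = Matrix.vecMul d A j := fun A j => rfl
  have hφ : Function.Surjective φ := by
    rintro ⟨u, v⟩
    obtain ⟨A, hA⟩ := vecMulHom_surjective d v
    -- Altering row 0 corrects e A, as e 0 = 1, and leaves d A unchanged, as d 0 = 0.
    refine ⟨A + Matrix.vecMulVec (Pi.single 0 1) (u - Matrix.vecMul e A), ?_⟩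
    ext j
    · rw [hφ1, Matrix.vecMul_add, Matrix.vecMul_vecMulVec]
      simp [he]
    · rw [hφ2, Matrix.vecMul_add, Matrix.vecMul_vecMulVec, ← hA]
      simp [hd, vecMulHom]
  have h := ncard_preimage_mul_card φ hφ {p | p.1 ∈ S ∧ (fun j => p.1 j + (p.2 j : R)) ∈ S}
  rw [Nat.card_prod, Nat.card_fun, Nat.card_fun, Nat.card_fin] at h
  let f : (Fin n → R) × (Fin n → I) → (Fin n → R) × (Fin n → R) :=
    fun p => (p.1, fun j => p.1 j + (p.2 j : R))
  have hinj : Function.Injective f := by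
    rintro ⟨u, v⟩ ⟨u', v'⟩ hv
    simp only [f, Prod.mk.injEq] at hv
    obtain ⟨rfl, hv⟩ := hv
    refine Prod.ext rfl (funext fun j => Subtype.ext ?_)
    simpa using congrFun hv j
  have himg : {p : (Fin n → R) × (Fin n → R) |
        p.1 ∈ S ∧ p.2 ∈ S ∧ ∀ j, p.2 j - p.1 j ∈ I}
      = f '' {p | p.1 ∈ S ∧ (fun j => p.1 j + (p.2 j : R)) ∈ S} := by
    ext ⟨u, u'⟩
    constructor
    · rintro ⟨h1, h2, h3⟩
      refine ⟨(u, fun j => ⟨u' j - u j, h3 j⟩), ⟨h1, ?_⟩, ?_⟩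
      · simpa using h2
      · simp [f]
    · rintro ⟨⟨w, v⟩, hv, he⟩
      simp only [f, Prod.mk.injEq] at he
      obtain ⟨rfl, rfl⟩ := he
      exact ⟨hv.1, hv.2, fun j => by simp⟩
  rw [himg, Set.ncard_image_of_injective _ hinj, ← h]
  congr 2
  ext A
  simp only [Set.mem_preimage]
  refine and_congr Iff.rfl ?_
  rw [Matrix.add_vecMul]
  rfl

variable [Fintype R] [Fintype (Ideal R)]

/-- Group the vectors by the ideal they generate; those generating I all lie in I^k. -/
theorem sum_span_range_le (k : ℕ) (f : Ideal R → ℝ) (hf : ∀ I, 0 ≤ f I) :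
    ∑ b : Fin k → R, f (Ideal.span (Set.range b)) ≤ ∑ I : Ideal R, (Nat.card I : ℝ) ^ k * f I := by
  classical
  rw [← Finset.sum_fiberwise (s := Finset.univ)
    (g := fun b : Fin k → R => Ideal.span (Set.range b))]
  refine Finset.sum_le_sum fun I _ => ?_
  rw [Finset.sum_congr rfl (g := fun _ => f I)
    (fun b hb => by rw [(Finset.mem_filter.1 hb).2]), Finset.sum_const, nsmul_eq_mul]
  refine mul_le_mul_of_nonneg_right ?_ (hf I)
  have h : Nat.card (Fin k → I) = Nat.card I ^ k := by rw [Nat.card_fun, Nat.card_fin]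
  rw [← Nat.cast_pow, ← h, Nat.cast_le, ← Set.ncard_univ, ← Set.ncard_coe_finset]
  refine Set.ncard_le_ncard_of_injOn
    -- The default 0 is never reached on vectors that generate I.
    (fun b i => if h : b i ∈ I then (⟨b i, h⟩ : I) else 0) (fun _ _ => Set.mem_univ _) ?_
  intro b hb b' hb' hbb
  have hm : ∀ b : Fin k → R, Ideal.span (Set.range b) = I → ∀ i, b i ∈ I := fun b h i =>
    h ▸ Ideal.subset_span ⟨i, rfl⟩
  have h1 := hm b (by simpa using hb)
  have h2 := hm b' (by simpa using hb')
  funext i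
  have := congrFun hbb i
  simpa [h1 i, h2 i] using this

/-- The union bound over the coefficient vectors, grouped by the ideals they generate. -/
theorem ncard_exists_vecMul_mem_le (S : Set (Fin n → R)) (c : Ideal R → ℝ)
    (hc : ∀ I : Ideal R, ({u : Fin n → R | (∀ j, u j ∈ I) ∧ u ∈ S}.ncard : ℝ) ≤ c I) :
    ({A : Matrix (Fin k) (Fin n) R | ∃ b, b ≠ 0 ∧ Matrix.vecMul b A ∈ S}.ncard : ℝ)
      ≤ Nat.card (Matrix (Fin k) (Fin n) R) *
        ∑ I ∈ Finset.univ.filter (fun I : Ideal R => I ≠ ⊥),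
          (Nat.card I : ℝ) ^ k * (c I / (Nat.card I : ℝ) ^ n) := by
  classical
  set M : ℝ := ((Nat.card (Matrix (Fin k) (Fin n) R) : ℕ) : ℝ) with hM
  have hI : ∀ I : Ideal R, (0 : ℝ) < Nat.card I := fun I => by exact_mod_cast Nat.card_pos
  have hc0 : ∀ I, 0 ≤ c I := fun I => (Nat.cast_nonneg _).trans (hc I)
  have hb : ∀ b : Fin k → R, ({A : Matrix (Fin k) (Fin n) R | Matrix.vecMul b A ∈ S}.ncard : ℝ)
      ≤ M * (c (Ideal.span (Set.range b)) / (Nat.card (Ideal.span (Set.range b)) : ℝ) ^ n) := by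
    intro b
    have h := ncard_vecMul_mem b S
    have hpos := hI (Ideal.span (Set.range b))
    rw [mul_div_assoc', le_div_iff₀ (by positivity)]
    calc _ = M * ({u : Fin n → R | (∀ j, u j ∈ Ideal.span (Set.range b)) ∧ u ∈ S}.ncard : ℝ) := by
          rw [hM]; exact_mod_cast h
      _ ≤ _ := by gcongr; exact hc _
  have hsub : {A : Matrix (Fin k) (Fin n) R | ∃ b, b ≠ 0 ∧ Matrix.vecMul b A ∈ S}
      ⊆ ⋃ b : Fin k → R, {A | b ≠ 0 ∧ Matrix.vecMul b A ∈ S} := by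
    rintro A ⟨b, hb⟩
    exact Set.mem_iUnion.2 ⟨b, hb⟩
  have h1 := (Set.ncard_le_ncard hsub (Set.toFinite _)).trans (Set.ncard_iUnion_le_of_fintype _)
  let f : Ideal R → ℝ := fun I => if I ≠ ⊥ then c I / (Nat.card I : ℝ) ^ n else 0
  have hf : ∀ I, 0 ≤ f I := fun I => by
    simp only [f]; split_ifs
    · exact div_nonneg (hc0 I) (by positivity)
    · rfl
  calc _ ≤ ∑ b : Fin k → R,
        ({A : Matrix (Fin k) (Fin n) R | b ≠ 0 ∧ Matrix.vecMul b A ∈ S}.ncard : ℝ) := by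
        exact_mod_cast h1
    _ ≤ ∑ b : Fin k → R, M * f (Ideal.span (Set.range b)) := by
        refine Finset.sum_le_sum fun b _ => ?_
        by_cases h0 : b = 0
        · simp only [h0, ne_eq, not_true_eq_false, false_and]
          have h2 : 0 ≤ M * f (Ideal.span (Set.range (0 : Fin k → R))) :=
            mul_nonneg (Nat.cast_nonneg _) (hf _)
          simpa using h2
        · have hne : Ideal.span (Set.range b) ≠ ⊥ := by
            intro h
            rw [Ideal.span_eq_bot] at h
            exact h0 (funext fun i => h _ ⟨i, rfl⟩)
          simp only [f, if_pos hne]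
          refine le_trans (le_of_eq ?_) (hb b)
          simp [h0]
    _ = M * ∑ b : Fin k → R, f (Ideal.span (Set.range b)) := by rw [Finset.mul_sum]
    _ ≤ M * ∑ I : Ideal R, (Nat.card I : ℝ) ^ k * f I := by
        gcongr; exact sum_span_range_le k f hf
    _ = _ := by
        rw [Finset.sum_filter]
        congr 1
        refine Finset.sum_congr rfl fun I _ => ?_
        simp only [f]; split_ifs <;> simp

/-- Chebyshev's inequality for the number of `b` with `(1, b) A ∈ S`: the pairs `(1, b)`,
`(1, b) + d` are independent unless `d` generates a proper ideal. -/
theorem ncard_forall_vecMul_notMem_mul_le (k : ℕ) (S : Set (Fin n → R)) (c : Ideal R → ℝ)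
    (hc0 : ∀ I, 0 ≤ c I)
    (hc : ∀ I : Ideal R, ∀ u ∈ S,
      ({u' : Fin n → R | (∀ j, u' j - u j ∈ I) ∧ u' ∈ S}.ncard : ℝ) ≤ c I) :
    ({A : Matrix (Fin (k + 1)) (Fin n) R | ∀ b : Fin k → R,
        Matrix.vecMul (Fin.cons 1 b : Fin (k + 1) → R) A ∉ S}.ncard : ℝ)
      * ((Nat.card R : ℝ) ^ k * (S.ncard / (Nat.card R : ℝ) ^ n))
      ≤ Nat.card (Matrix (Fin (k + 1)) (Fin n) R) *
        ∑ I ∈ Finset.univ.filter (fun I : Ideal R => I ≠ ⊤),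
          (Nat.card I : ℝ) ^ k * (c I / (Nat.card I : ℝ) ^ n) := by
  classical
  set M : ℝ := ((Nat.card (Matrix (Fin (k + 1)) (Fin n) R) : ℕ) : ℝ) with hM
  have hM0 : 0 < M := by rw [hM]; exact_mod_cast Nat.card_pos
  set r : ℝ := ((Nat.card R : ℕ) : ℝ) with hr
  have hr0 : 0 < r := by rw [hr]; exact_mod_cast Nat.card_pos
  set L : ℝ := ((S.ncard : ℕ) : ℝ) with hL
  have hL0 : 0 ≤ L := Nat.cast_nonneg _
  set μ : ℝ := r ^ k * (L / r ^ n) with hμ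
  have hμ0 : 0 ≤ μ := by positivity
  have hI : ∀ I : Ideal R, (0 : ℝ) < Nat.card I := fun I => by exact_mod_cast Nat.card_pos
  have hcf : ((Fintype.card (Fin k → R) : ℕ) : ℝ) = r ^ k := by
    rw [hr, ← Nat.card_eq_fintype_card, Nat.card_fun, Nat.card_fin, Nat.cast_pow]
  let e : (Fin k → R) → Fin (k + 1) → R := fun b => Fin.cons 1 b
  let z : (Fin k → R) → Fin (k + 1) → R := fun b => Fin.cons 0 b
  have hez : ∀ b d, e (b + d) = e b + z d := by
    intro b d
    funext i
    refine Fin.cases ?_ (fun i => ?_) i <;> simp [e, z]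
  have hspan : ∀ d, Ideal.span (Set.range (z d)) = Ideal.span (Set.range d) := by
    intro d
    simp only [z, Fin.range_cons, Ideal.span_insert_zero]
  let X : Matrix (Fin (k + 1)) (Fin n) R → ℝ := fun A =>
    ∑ b, if Matrix.vecMul (e b) A ∈ S then 1 else 0
  have hX : ∀ b A, X A = ∑ d, if Matrix.vecMul (e b + z d) A ∈ S then (1 : ℝ) else 0 := by
    intro b A
    simp only [← hez]
    exact (Equiv.sum_comp (Equiv.addLeft b)
      (fun b => if Matrix.vecMul (e b) A ∈ S then (1 : ℝ) else 0)).symm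
  have hfirst : ∑ A, X A = M * μ := by
    have h1 : ∀ b, ∑ A : Matrix (Fin (k + 1)) (Fin n) R,
        (if Matrix.vecMul (e b) A ∈ S then (1 : ℝ) else 0) = M * (L / r ^ n) := by
      intro b
      have h := ncard_vecMul_mem (e b) S
      have htop : Ideal.span (Set.range (e b)) = ⊤ :=
        Ideal.eq_top_of_isUnit_mem _ (Ideal.subset_span ⟨0, rfl⟩) (by simp [e])
      have hset : {u : Fin n → R | (∀ j, u j ∈ (⊤ : Ideal R)) ∧ u ∈ S} = S := by
        ext; simp
      have hct : Nat.card (⊤ : Ideal R) = Nat.card R := Nat.card_congr Submodule.topEquiv.toEquiv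
      rw [htop, hset, hct] at h
      have h2 := ncard_eq_sum_indicator
        {A : Matrix (Fin (k + 1)) (Fin n) R | Matrix.vecMul (e b) A ∈ S}
      simp only [Set.mem_ofPred_eq] at h2
      rw [← h2, mul_div_assoc', eq_div_iff (by positivity), hM, hL, hr]
      exact_mod_cast h
    rw [Finset.sum_comm, Finset.sum_congr rfl fun b _ => h1 b]
    simp only [Finset.sum_const, Finset.card_univ, nsmul_eq_mul, hcf, hμ]
    ring
  -- The value 0 at ⊤ records that such pairs are independent and add no covariance.
  let f : Ideal R → ℝ := fun I => if I ≠ ⊤ then c I / (Nat.card I : ℝ) ^ n else 0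
  have hf : ∀ I, 0 ≤ f I := fun I => by
    simp only [f]; split_ifs
    · exact div_nonneg (hc0 I) (by positivity)
    · rfl
  have hpair : ∀ b d, ∑ A : Matrix (Fin (k + 1)) (Fin n) R,
      ((if Matrix.vecMul (e b) A ∈ S then (1 : ℝ) else 0) *
        (if Matrix.vecMul (e b + z d) A ∈ S then (1 : ℝ) else 0))
      ≤ M * ((L / r ^ n) * (L / r ^ n + f (Ideal.span (Set.range d)))) := by
    intro b d
    set I := Ideal.span (Set.range d) with hId
    have hpos := hI I
    have h := ncard_vecMul_pair_mem (e b) (z d) rfl rfl S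
    rw [hspan, ← hId] at h
    have h2 := ncard_eq_sum_indicator {A : Matrix (Fin (k + 1)) (Fin n) R |
      Matrix.vecMul (e b) A ∈ S ∧ Matrix.vecMul (e b + z d) A ∈ S}
    simp only [Set.mem_ofPred_eq] at h2
    have h3 : ∀ A : Matrix (Fin (k + 1)) (Fin n) R,
        ((if Matrix.vecMul (e b) A ∈ S then (1 : ℝ) else 0) *
        (if Matrix.vecMul (e b + z d) A ∈ S then (1 : ℝ) else 0))
        = if Matrix.vecMul (e b) A ∈ S ∧ Matrix.vecMul (e b + z d) A ∈ S
          then (1 : ℝ) else 0 := by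
      intro A
      rw [ite_and, ite_mul, one_mul, zero_mul]
    rw [Finset.sum_congr rfl fun A _ => h3 A, ← h2]
    have h4 : (({A : Matrix (Fin (k + 1)) (Fin n) R |
        Matrix.vecMul (e b) A ∈ S ∧ Matrix.vecMul (e b + z d) A ∈ S}.ncard : ℕ) : ℝ)
        = M * (({p : (Fin n → R) × (Fin n → R) |
            p.1 ∈ S ∧ p.2 ∈ S ∧ ∀ j, p.2 j - p.1 j ∈ I}.ncard : ℕ) : ℝ)
          / (r ^ n * (Nat.card I : ℝ) ^ n) := by
      rw [eq_div_iff (by positivity), hM, hr]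
      exact_mod_cast h
    rw [h4, mul_div_assoc]
    refine mul_le_mul_of_nonneg_left ?_ hM0.le
    rw [div_le_iff₀ (by positivity)]
    -- For I = ⊤ the admissible pairs form S × S, and equality holds. Otherwise each first word in S
    -- leaves at most `c I` second words, and the squared term is spare.
    by_cases htop : I = ⊤
    · have hct : Nat.card I = Nat.card R := by
        rw [htop]; exact Nat.card_congr Submodule.topEquiv.toEquiv
      have hset : {p : (Fin n → R) × (Fin n → R) |
          p.1 ∈ S ∧ p.2 ∈ S ∧ ∀ j, p.2 j - p.1 j ∈ I} = S ×ˢ S := by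
        ext p; simp [htop]
      rw [hset, Set.ncard_prod, hct, ← hr, Nat.cast_mul, ← hL]
      simp only [f, htop, ne_eq, not_true_eq_false, if_false, add_zero]
      apply le_of_eq
      field_simp
    · have hcount : (({p : (Fin n → R) × (Fin n → R) |
            p.1 ∈ S ∧ p.2 ∈ S ∧ ∀ j, p.2 j - p.1 j ∈ I}.ncard : ℕ) : ℝ) ≤ L * c I := by
        rw [ncard_eq_sum_indicator, Fintype.sum_prod_type, hL, ncard_eq_sum_indicator S,
          Finset.sum_mul]
        refine Finset.sum_le_sum fun u _ => ?_
        by_cases hu : u ∈ S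
        · have h5 := hc I u hu
          rw [ncard_eq_sum_indicator] at h5
          simp only [Set.mem_ofPred_eq, hu, true_and, if_true, one_mul] at h5 ⊢
          simpa only [and_comm] using h5
        · simp [hu]
      simp only [f, ne_eq, htop, not_false_eq_true, if_true]
      refine hcount.trans ?_
      have : L / r ^ n * (L / r ^ n + c I / (Nat.card I : ℝ) ^ n) * (r ^ n * (Nat.card I : ℝ) ^ n)
          = L * c I + L * (L / r ^ n) * (Nat.card I : ℝ) ^ n := by
        field_simp; ring
      rw [this]
      exact le_add_of_nonneg_right (by positivity)
  set V : ℝ := ∑ I : Ideal R, (Nat.card I : ℝ) ^ k * f I with hV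
  have hsecond : ∑ A, X A ^ 2 ≤ M * (μ ^ 2 + μ * V) := by
    have h1 : ∀ A, X A ^ 2 = ∑ b, ∑ d, ((if Matrix.vecMul (e b) A ∈ S then (1 : ℝ) else 0) *
        (if Matrix.vecMul (e b + z d) A ∈ S then (1 : ℝ) else 0)) := by
      intro A
      rw [sq]
      conv_lhs => rw [show X A = ∑ b, if Matrix.vecMul (e b) A ∈ S then (1 : ℝ) else 0 from rfl]
      rw [Finset.sum_mul]
      refine Finset.sum_congr rfl fun b _ => ?_
      rw [← Finset.mul_sum, ← hX b A]
    calc ∑ A, X A ^ 2 = ∑ b, ∑ d, ∑ A : Matrix (Fin (k + 1)) (Fin n) R,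
          ((if Matrix.vecMul (e b) A ∈ S then (1 : ℝ) else 0) *
          (if Matrix.vecMul (e b + z d) A ∈ S then (1 : ℝ) else 0)) := by
          rw [Finset.sum_congr rfl fun A _ => h1 A, Finset.sum_comm]
          refine Finset.sum_congr rfl fun b _ => Finset.sum_comm
      _ ≤ ∑ _b : Fin k → R, ∑ d : Fin k → R,
          M * ((L / r ^ n) * (L / r ^ n + f (Ideal.span (Set.range d)))) :=
          Finset.sum_le_sum fun b _ => Finset.sum_le_sum fun d _ => hpair b d
      _ = M * (μ ^ 2 + μ * ∑ d : Fin k → R, f (Ideal.span (Set.range d))) := by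
          simp only [← Finset.mul_sum, Finset.sum_add_distrib, Finset.sum_const, Finset.card_univ,
            nsmul_eq_mul, hcf, hμ]
          ring
      _ ≤ _ := by
          gcongr
          exact sum_span_range_le k f hf
  have hVeq : V = ∑ I ∈ Finset.univ.filter (fun I : Ideal R => I ≠ ⊤),
      (Nat.card I : ℝ) ^ k * (c I / (Nat.card I : ℝ) ^ n) := by
    rw [Finset.sum_filter, hV]
    refine Finset.sum_congr rfl fun I _ => ?_
    simp only [f]; split_ifs <;> simp
  rw [← hVeq]
  have hV0 : 0 ≤ V := Finset.sum_nonneg fun I _ => mul_nonneg (by positivity) (hf I)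
  refine le_trans ?_ (ncard_eq_zero_mul_le X hμ0 hV0 (by rw [hfirst, hM, Nat.card_eq_fintype_card])
    (by rw [← Nat.card_eq_fintype_card]; exact hsecond)) |>.trans_eq ?_
  · refine mul_le_mul_of_nonneg_right (Nat.cast_le.2 (Set.ncard_le_ncard ?_ (Set.toFinite _))) hμ0
    exact fun A hA => Finset.sum_eq_zero fun b _ => if_neg (hA b)
  · rw [← Nat.card_eq_fintype_card]

end Ring

/-! ### Exponential convergence from eventual bounds. -/

theorem TendstoExponentially.of_eventually_le {u : ℕ → ℝ} {l C c : ℝ} (hc : 0 < c)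
    (hu : ∀ n, |u n - l| ≤ 1)
    (h : ∀ᶠ n : ℕ in atTop, |u n - l| ≤ C * Real.exp (-c * n)) : TendstoExponentially u l := by
  obtain ⟨N, hN⟩ := eventually_atTop.1 h
  have hb : ∀ n : ℕ, |u n - l| ≤ (|C| + Real.exp (c * N)) * Real.exp (-c * n) := by
    intro n
    rw [add_mul]
    rcases le_total N n with hn | hn
    · refine (hN n hn).trans ?_
      have : C * Real.exp (-c * n) ≤ |C| * Real.exp (-c * n) := by gcongr; exact le_abs_self C
      have h2 : 0 ≤ Real.exp (c * N) * Real.exp (-c * n) := by positivity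
      linarith
    · refine (hu n).trans ?_
      have h1 : 0 ≤ |C| * Real.exp (-c * n) := by positivity
      have h2 : 1 ≤ Real.exp (c * N) * Real.exp (-c * n) := by
        rw [← Real.exp_add]
        apply Real.one_le_exp
        have : (n : ℝ) ≤ N := by exact_mod_cast hn
        nlinarith
      linarith
  -- The summand e^(cN) makes the bound at least 1 for all n ≤ N, where only |u n - l| ≤ 1 is known.
  refine ⟨?_, |C| + Real.exp (c * N), by positivity, c, hc, hb⟩
  rw [tendsto_iff_norm_sub_tendsto_zero]
  refine squeeze_zero (fun _ => norm_nonneg _) hb ?_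
  rw [← mul_zero (|C| + Real.exp (c * N))]
  refine Tendsto.const_mul _ (Real.tendsto_exp_atBot.comp ?_)
  exact tendsto_natCast_atTop_atTop.const_mul_atTop_of_neg (by linarith)

/-- `q^(a - b n) = q^a e^(-(b log q) n)`. -/
theorem rpow_sub_mul_natCast {q : ℝ} (hq : 0 < q) (a b : ℝ) (n : ℕ) :
    q ^ (a - n * b) = q ^ a * Real.exp (-(b * Real.log q) * n) := by
  rw [sub_eq_add_neg, Real.rpow_add hq, Real.rpow_def_of_pos hq (-(n * b))]
  congr 2
  ring

/-! ### Random quasi-abelian codes below and above the Gilbert-Varshamov bound. -/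

section

variable {F G : Type*} [Field F] [CommGroup G]

theorem lt_relDistance_iff [Finite G] {n : ℕ} (hn : 0 < n)
    (C : Submodule (MonoidAlgebra F G) (Fin n → MonoidAlgebra F G)) {δ : ℝ} (hδ : 0 ≤ δ) :
    ENNReal.ofReal δ < relDistance C ↔
      ∀ c ∈ C, c ≠ 0 → δ * (Nat.card G * n : ℕ) < weight c := by
  have hN : 0 < Nat.card G * n := Nat.mul_pos Nat.card_pos hn
  have hN0 : ((Nat.card G * n : ℕ) : ENNReal) ≠ 0 := by exact_mod_cast hN.ne'
  have hw : ∀ w : ℕ, ENNReal.ofReal δ * ((Nat.card G * n : ℕ) : ENNReal) < (w : ENNReal) ↔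
      δ * (Nat.card G * n : ℕ) < w := by
    intro w
    rw [← ENNReal.ofReal_natCast (Nat.card G * n), ← ENNReal.ofReal_mul hδ,
      ← ENNReal.ofReal_natCast w]
    exact ENNReal.ofReal_lt_ofReal_iff_of_nonneg (by positivity)
  rw [relDistance, ENNReal.lt_div_iff_mul_lt (Or.inl hN0) (Or.inl (ENNReal.natCast_ne_top _))]
  constructor
  · intro h c hc h0
    rw [← hw]
    refine h.trans_le ?_
    have : minWeight C ≤ (weight c : ℕ∞) :=
      iInf_le (fun c : {c // c ∈ C ∧ c ≠ 0} => (weight c.1 : ℕ∞)) ⟨c, hc, h0⟩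
    exact_mod_cast ENat.toENNReal_le.2 this
  · intro h
    -- The zero code has minimum weight ⊤, and otherwise the infimum in `ℕ∞` is attained.
    rcases isEmpty_or_nonempty {c // c ∈ C ∧ c ≠ 0} with he | he
    · rw [minWeight, iInf_of_empty, ENat.toENNReal_top]
      exact ENNReal.mul_lt_top ENNReal.ofReal_lt_top (ENNReal.natCast_lt_top _)
    · obtain ⟨c, hc⟩ := ciInf_mem
        (fun c : {c // c ∈ C ∧ c ≠ 0} => (weight c.1 : ℕ∞))
      rw [minWeight, ← hc, ENat.toENNReal_coe, hw]
      exact h c.1 c.2.1 c.2.2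

theorem isFullRank_iff_vecMul_ne_zero {k n : ℕ}
    (A : Matrix (Fin k) (Fin n) (MonoidAlgebra F G)) :
    IsFullRank A ↔ ∀ b, b ≠ 0 → Matrix.vecMul b A ≠ 0 := by
  have hi : IsFullRank A ↔ Function.Injective A.vecMulLinear := Matrix.vecMul_injective_iff.symm
  rw [hi, injective_iff_map_eq_zero]
  exact forall_congr' fun b => not_imp_not.symm

theorem vecMul_mem_code {k n : ℕ} (A : Matrix (Fin k) (Fin n) (MonoidAlgebra F G))
    (b : Fin k → MonoidAlgebra F G) : Matrix.vecMul b A ∈ code A :=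
  ⟨b, rfl⟩

theorem mem_code_iff {k n : ℕ} {A : Matrix (Fin k) (Fin n) (MonoidAlgebra F G)}
    {c : Fin n → MonoidAlgebra F G} : c ∈ code A ↔ ∃ b, Matrix.vecMul b A = c :=
  Iff.rfl

/-- Words in `(FG)^n` of relative weight at most `δ`. -/
def lightWords (F G : Type*) [Field F] [CommGroup G] (n : ℕ) (δ : ℝ) :
    Set (Fin n → MonoidAlgebra F G) :=
  {u | (weight u : ℝ) ≤ δ * (Nat.card G * n : ℕ)}

theorem probFullRank_nonneg (k n : ℕ) (δ : ℝ) : 0 ≤ probFullRank F G k n δ := by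
  unfold probFullRank; positivity

variable [Finite F] [Finite G]

theorem probFullRank_le_one (k n : ℕ) (δ : ℝ) : probFullRank F G k n δ ≤ 1 := by
  have := finite_monoidAlgebra (F := F) (G := G)
  refine div_le_one_of_le₀ (Nat.cast_le.2 ?_) (Nat.cast_nonneg _)
  exact Nat.card_mono (Set.toFinite _) fun A hA => hA.1

/-- The union bound over a set of words that meets every `I^n` in at most `C q^(h n dim I)`
words. -/
theorem ncard_exists_vecMul_mem_le_rpow {k n : ℕ} {r h C : ℝ} (hC : 0 ≤ C)
    (hk : |(k : ℝ) - r * n| ≤ 1 / 2)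
    (hr : r ≤ 1 - h) (S : Set (Fin n → MonoidAlgebra F G))
    (hS : ∀ I : Ideal (MonoidAlgebra F G),
      ({u : Fin n → MonoidAlgebra F G | (∀ j, u j ∈ I) ∧ u ∈ S}.ncard : ℝ)
        ≤ C * (Nat.card F : ℝ) ^ (h * (n * Module.finrank F I : ℕ))) :
    ({A : Matrix (Fin k) (Fin n) (MonoidAlgebra F G) |
        ∃ b, b ≠ 0 ∧ Matrix.vecMul b A ∈ S}.ncard : ℝ)
      ≤ Nat.card (Matrix (Fin k) (Fin n) (MonoidAlgebra F G)) *
        (Nat.card (Ideal (MonoidAlgebra F G)) * C *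
          (Nat.card F : ℝ) ^ ((Nat.card G : ℝ) / 2 - n * (1 - h - r))) := by
  classical
  have := finite_monoidAlgebra (F := F) (G := G)
  have := Fintype.ofFinite (MonoidAlgebra F G)
  have := Fintype.ofFinite (Ideal (MonoidAlgebra F G))
  have hq : (1 : ℝ) < Nat.card F := by exact_mod_cast Finite.one_lt_card
  refine (ncard_exists_vecMul_mem_le S _ hS).trans ?_
  refine mul_le_mul_of_nonneg_left ?_ (Nat.cast_nonneg _)
  rw [Nat.card_eq_fintype_card (α := Ideal (MonoidAlgebra F G)), mul_assoc, ← nsmul_eq_mul]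
  refine (Finset.sum_le_card_nsmul _ _ _ fun I hI => ?_).trans
    (nsmul_le_nsmul_left (by positivity) (Finset.card_le_univ _))
  have hd1 : (1 : ℝ) ≤ Module.finrank F I := by
    exact_mod_cast one_le_finrank_ideal (Finset.mem_filter.1 hI).2
  have hdm : (Module.finrank F I : ℝ) ≤ Nat.card G := by
    have := moduleFinite_monoidAlgebra (F := F) (G := G)
    rw [← finrank_monoidAlgebra (F := F) (G := G)]
    exact_mod_cast Submodule.finrank_le (I.restrictScalars F)
  rw [card_ideal]
  set d := Module.finrank F I
  have e : ((Nat.card F ^ d : ℕ) : ℝ) ^ k * (C * (Nat.card F : ℝ) ^ (h * (n * d : ℕ)) /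
      ((Nat.card F ^ d : ℕ) : ℝ) ^ n) = C * (Nat.card F : ℝ) ^ ((d : ℝ) * (k - n + h * n)) := by
    push_cast
    rw [← pow_mul, ← pow_mul, ← Real.rpow_natCast, ← Real.rpow_natCast, mul_div_assoc,
      ← Real.rpow_sub (by linarith), mul_left_comm, ← Real.rpow_add (by linarith)]
    congr 2
    push_cast
    ring
  rw [e]
  refine mul_le_mul_of_nonneg_left (Real.rpow_le_rpow_of_exponent_le hq.le ?_) hC
  have hk1 : (k : ℝ) ≤ r * n + 1 / 2 := by linarith [(abs_le.1 hk).2]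
  -- Since 1 ≤ d ≤ m, the rounding error d/2 is worst at d = m and the decay is worst at d = 1.
  have h1 : (d : ℝ) * (k - n + h * n) ≤ d * (1 / 2 - n * (1 - h - r)) := by
    apply mul_le_mul_of_nonneg_left _ (by linarith); linarith
  have h2 : (0 : ℝ) ≤ n * (1 - h - r) := mul_nonneg (Nat.cast_nonneg _) (by linarith)
  nlinarith

/-- Failure probability below the Gilbert-Varshamov bound. -/
theorem one_sub_probFullRank_le {k n : ℕ} (hn : 0 < n) {r δ : ℝ} (h0 : 0 < δ)
    (h1 : δ < 1 - (Nat.card F : ℝ)⁻¹) (hk : |(k : ℝ) - r * n| ≤ 1 / 2)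
    (hr : r < gvBound (Nat.card F) δ) :
    1 - probFullRank F G k n δ ≤ Nat.card (Ideal (MonoidAlgebra F G)) * Nat.card G *
      (Nat.card F : ℝ) ^ ((Nat.card G : ℝ) / 2 - n * (gvBound (Nat.card F) δ - r)) := by
  have := finite_monoidAlgebra (F := F) (G := G)
  set E := (Nat.card (Ideal (MonoidAlgebra F G)) : ℝ) * Nat.card G *
      (Nat.card F : ℝ) ^ ((Nat.card G : ℝ) / 2 - n * (gvBound (Nat.card F) δ - r)) with hE
  set M := Nat.card (Matrix (Fin k) (Fin n) (MonoidAlgebra F G)) with hM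
  have hMpos : (0 : ℝ) < M := by rw [hM]; exact_mod_cast Nat.card_pos
  have hbad := ncard_exists_vecMul_mem_le_rpow (k := k) (r := r)
    (h := entropy (Nat.card F) δ) (C := Nat.card G) (Nat.cast_nonneg _) hk
    (by rw [gvBound] at hr; exact hr.le) (lightWords F G n δ) (by
      intro I
      simpa [lightWords] using ncard_coset_light_le h0 h1 I 0)
  rw [← hM, ← gvBound, ← hE] at hbad
  set bad := {A : Matrix (Fin k) (Fin n) (MonoidAlgebra F G) |
        ∃ b, b ≠ 0 ∧ Matrix.vecMul b A ∈ lightWords F G n δ} with hb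
  set good := {A : Matrix (Fin k) (Fin n) (MonoidAlgebra F G) |
      IsFullRank A ∧ ENNReal.ofReal δ < relDistance (code A)} with hg
  -- The zero word is light, so avoiding light words also forces full rank.
  have hsub : badᶜ ⊆ good := by
    intro A hA
    have hA' : ∀ b, b ≠ 0 → δ * (Nat.card G * n : ℕ) < weight (Matrix.vecMul b A) := by
      intro b hb0
      by_contra hcon
      exact hA ⟨b, hb0, not_lt.1 hcon⟩
    refine ⟨(isFullRank_iff_vecMul_ne_zero A).2 fun b hb0 h => ?_,
      (lt_relDistance_iff hn _ h0.le).2 ?_⟩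
    · have := hA' b hb0
      rw [h] at this
      have h2 : (0 : ℝ) ≤ δ * (Nat.card G * n : ℕ) := by positivity
      simp only [weight, Pi.zero_apply, MonoidAlgebra.coeff_zero, Finsupp.support_zero,
        Finset.card_empty, Finset.sum_const_zero, Nat.cast_zero] at this
      linarith
    · intro c hc hc0
      obtain ⟨b, rfl⟩ := mem_code_iff.1 hc
      exact hA' b (by rintro rfl; simp at hc0)
  have hcount : (M : ℝ) ≤ bad.ncard + good.ncard := by
    have e1 := Set.ncard_add_ncard_compl bad
    have e2 := Set.ncard_le_ncard hsub (Set.toFinite _)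
    rw [← hM] at e1
    exact_mod_cast (by omega : M ≤ bad.ncard + good.ncard)
  -- Dropping rank-deficient matrices from the denominator can only raise the quotient; if none has
  -- full rank, both sides are 0.
  have hgood : (good.ncard : ℝ) / M ≤ probFullRank F G k n δ := by
    rw [probFullRank]
    change _ ≤ (good.ncard : ℝ) / _
    set FR := {A : Matrix (Fin k) (Fin n) (MonoidAlgebra F G) | IsFullRank A} with hFR
    change _ ≤ (good.ncard : ℝ) / (FR.ncard : ℝ)
    have hle : good.ncard ≤ FR.ncard := Set.ncard_le_ncard (fun A hA => hA.1) (Set.toFinite _)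
    rcases Nat.eq_zero_or_pos FR.ncard with hz | hz
    · have : good.ncard = 0 := by omega
      simp [this]
    · refine div_le_div_of_nonneg_left (Nat.cast_nonneg _) (by exact_mod_cast hz) ?_
      exact_mod_cast Set.ncard_le_card FR
  have : 1 - E ≤ (good.ncard : ℝ) / M := by
    rw [le_div_iff₀ hMpos]
    linarith
  linarith

/-- At least half of all matrices have full rank, for large `n`. -/
theorem eventually_card_le_two_mul_card_isFullRank {r : ℝ} (hr : r < 1) {k : ℕ → ℕ}
    (hk : ∀ n : ℕ, |(k n : ℝ) - r * n| ≤ 1 / 2) :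
    ∀ᶠ n in atTop, (Nat.card (Matrix (Fin (k n)) (Fin n) (MonoidAlgebra F G)) : ℝ)
      ≤ 2 * {A : Matrix (Fin (k n)) (Fin n) (MonoidAlgebra F G) | IsFullRank A}.ncard := by
  have := finite_monoidAlgebra (F := F) (G := G)
  have hq : (1 : ℝ) < Nat.card F := by exact_mod_cast Finite.one_lt_card
  have hlim : Tendsto (fun n : ℕ => (Nat.card (Ideal (MonoidAlgebra F G)) : ℝ) * 1 *
      (Nat.card F : ℝ) ^ ((Nat.card G : ℝ) / 2 - n * (1 - 0 - r))) atTop (𝓝 0) := by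
    simp_rw [rpow_sub_mul_natCast (by linarith : (0 : ℝ) < Nat.card F)]
    rw [← mul_zero ((Nat.card (Ideal (MonoidAlgebra F G)) : ℝ) * 1)]
    refine Tendsto.const_mul _ ?_
    rw [← mul_zero ((Nat.card F : ℝ) ^ ((Nat.card G : ℝ) / 2))]
    refine Tendsto.const_mul _ (Real.tendsto_exp_atBot.comp ?_)
    refine tendsto_natCast_atTop_atTop.const_mul_atTop_of_neg ?_
    have := mul_pos (by linarith : 0 < 1 - 0 - r) (Real.log_pos hq)
    linarith
  filter_upwards [hlim.eventually_le_const (by norm_num : (0 : ℝ) < 1 / 2)] with n hn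
  set M := Nat.card (Matrix (Fin (k n)) (Fin n) (MonoidAlgebra F G)) with hM
  -- The target {0} has at most one word in each I^n, hence h = 0 and C = 1.
  have hbad := ncard_exists_vecMul_mem_le_rpow (F := F) (G := G) (k := k n) (r := r)
    (h := 0) (C := 1) zero_le_one (hk n) (by linarith) {0} (by
      intro I
      rw [zero_mul, Real.rpow_zero, mul_one, ← Nat.cast_one, Nat.cast_le,
        ← Set.ncard_singleton (0 : Fin n → MonoidAlgebra F G)]
      exact Set.ncard_le_ncard (fun u hu => hu.2) (Set.toFinite _))
  rw [← hM] at hbad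
  set bad := {A : Matrix (Fin (k n)) (Fin n) (MonoidAlgebra F G) |
        ∃ b, b ≠ 0 ∧ Matrix.vecMul b A ∈ ({0} : Set (Fin n → MonoidAlgebra F G))} with hb
  have hcompl : badᶜ = {A | IsFullRank A} := by
    ext A
    simp [hb, isFullRank_iff_vecMul_ne_zero]
  have e1 : (bad.ncard : ℝ) + (badᶜ.ncard : ℝ) = M := by
    exact_mod_cast Set.ncard_add_ncard_compl bad
  rw [← hcompl]
  have h2 : (M : ℝ) * ((Nat.card (Ideal (MonoidAlgebra F G)) : ℝ) * 1 *
      (Nat.card F : ℝ) ^ ((Nat.card G : ℝ) / 2 - n * (1 - 0 - r))) ≤ M * (1 / 2) := by gcongr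
  linarith

/-- The second-moment bound for the matrices `A` for which no word `(1, b) A` is light. -/
theorem ncard_forall_vecMul_notMem_lightWords_le {k n : ℕ} {r δ h : ℝ} (h0 : 0 < δ)
    (h1 : δ < 1 - (Nat.card F : ℝ)⁻¹) (hk : |((k + 1 : ℕ) : ℝ) - r * n| ≤ 1 / 2)
    (hr : gvBound (Nat.card F) δ ≤ r)
    (hL : (Nat.card F : ℝ) ^ (h * (Nat.card G * n : ℕ)) ≤ (lightWords F G n δ).ncard) :
    ({A : Matrix (Fin (k + 1)) (Fin n) (MonoidAlgebra F G) | ∀ b : Fin k → MonoidAlgebra F G,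
        Matrix.vecMul (Fin.cons 1 b : Fin (k + 1) → MonoidAlgebra F G) A
          ∉ lightWords F G n δ}.ncard : ℝ)
      ≤ Nat.card (Matrix (Fin (k + 1)) (Fin n) (MonoidAlgebra F G)) *
        (Nat.card (Ideal (MonoidAlgebra F G)) * Nat.card G *
          (Nat.card F : ℝ) ^ (3 / 2 * (Nat.card G : ℝ) - n * (r - gvBound (Nat.card F) δ
            - Nat.card G * (entropy (Nat.card F) δ - h)))) := by
  classical
  have := finite_monoidAlgebra (F := F) (G := G)
  have := Fintype.ofFinite (MonoidAlgebra F G)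
  have := Fintype.ofFinite (Ideal (MonoidAlgebra F G))
  have hq : (1 : ℝ) < Nat.card F := by exact_mod_cast Finite.one_lt_card
  have hq0 : (0 : ℝ) < Nat.card F := by linarith
  have hm0 : (0 : ℝ) < Nat.card G := by exact_mod_cast Nat.card_pos
  have hk1 := abs_le.1 hk
  push_cast at hk1
  have key := ncard_forall_vecMul_notMem_mul_le k (lightWords F G n δ)
    (fun I => Nat.card G *
      (Nat.card F : ℝ) ^ (entropy (Nat.card F) δ * (n * Module.finrank F I : ℕ)))
    (fun I => by positivity) (fun I u _ => ncard_coset_light_le h0 h1 I u)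
  set N0 : ℝ := (({A : Matrix (Fin (k + 1)) (Fin n) (MonoidAlgebra F G) |
    ∀ b : Fin k → MonoidAlgebra F G,
        Matrix.vecMul (Fin.cons 1 b : Fin (k + 1) → MonoidAlgebra F G) A
          ∉ lightWords F G n δ}.ncard : ℕ) : ℝ) with hN0
  set g := gvBound (Nat.card F) δ with hg
  set H := entropy (Nat.card F) δ with hH
  have hgH : g = 1 - H := rfl
  have hsum : ∑ I ∈ Finset.univ.filter (fun I : Ideal (MonoidAlgebra F G) => I ≠ ⊤),
      (Nat.card I : ℝ) ^ k * (Nat.card G * (Nat.card F : ℝ) ^ (H * (n * Module.finrank F I : ℕ))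
        / (Nat.card I : ℝ) ^ n)
      ≤ Nat.card (Ideal (MonoidAlgebra F G)) * (Nat.card G *
        (Nat.card F : ℝ) ^ (((Nat.card G : ℝ) - 1) * (n * (r - g)))) := by
    rw [Nat.card_eq_fintype_card (α := Ideal (MonoidAlgebra F G)), ← nsmul_eq_mul]
    refine (Finset.sum_le_card_nsmul _ _ _ fun I hI => ?_).trans
      (nsmul_le_nsmul_left (by positivity) (Finset.card_le_univ _))
    have hd : (Module.finrank F I : ℝ) ≤ Nat.card G - 1 := by
      have := finrank_ideal_lt (Finset.mem_filter.1 hI).2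
      rw [le_sub_iff_add_le]
      exact_mod_cast this
    rw [card_ideal]
    set d := Module.finrank F I
    have e : ((Nat.card F ^ d : ℕ) : ℝ) ^ k * (Nat.card G * (Nat.card F : ℝ) ^ (H * (n * d : ℕ)) /
        ((Nat.card F ^ d : ℕ) : ℝ) ^ n)
        = Nat.card G * (Nat.card F : ℝ) ^ ((d : ℝ) * (k - n + H * n)) := by
      push_cast
      rw [← pow_mul, ← pow_mul, ← Real.rpow_natCast, ← Real.rpow_natCast, mul_div_assoc,
        ← Real.rpow_sub (by linarith), mul_left_comm, ← Real.rpow_add (by linarith)]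
      congr 2
      push_cast
      ring
    rw [e]
    refine mul_le_mul_of_nonneg_left (Real.rpow_le_rpow_of_exponent_le hq.le ?_) hm0.le
    have hd0 : (0 : ℝ) ≤ d := Nat.cast_nonneg _
    calc (d : ℝ) * (k - n + H * n) ≤ d * (n * (r - g)) := by
          apply mul_le_mul_of_nonneg_left _ hd0
          rw [hgH]; linarith [hk1.2]
      _ ≤ _ := by
          apply mul_le_mul_of_nonneg_right hd
          exact mul_nonneg (Nat.cast_nonneg _) (by linarith)
  -- The 3/2 combines the rounding error 1/2 with the coordinate fixed to 1: only k of the k + 1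
  -- coordinates vary.
  have hmean : (Nat.card F : ℝ) ^ ((Nat.card G : ℝ) * (n * (r - g - (H - h)) - 3 / 2))
      ≤ (Nat.card (MonoidAlgebra F G) : ℝ) ^ k * ((lightWords F G n δ).ncard /
        (Nat.card (MonoidAlgebra F G) : ℝ) ^ n) := by
    rw [card_monoidAlgebra]
    push_cast
    calc _ ≤ (Nat.card F : ℝ) ^ ((Nat.card G : ℝ) * (k - n + h * n)) := by
          apply Real.rpow_le_rpow_of_exponent_le hq.le
          apply mul_le_mul_of_nonneg_left _ hm0.le
          rw [hgH]; linarith [hk1.1]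
      _ = ((Nat.card F : ℝ) ^ Nat.card G) ^ k * ((Nat.card F : ℝ) ^ (h * (Nat.card G * n : ℕ)) /
          ((Nat.card F : ℝ) ^ Nat.card G) ^ n) := by
          rw [← pow_mul, ← pow_mul, ← Real.rpow_natCast, ← Real.rpow_natCast,
            ← Real.rpow_sub hq0, ← Real.rpow_add hq0]
          congr 1
          push_cast
          ring
      _ ≤ _ := by gcongr
  have hpos : 0 < (Nat.card F : ℝ) ^ ((Nat.card G : ℝ) * (n * (r - g - (H - h)) - 3 / 2)) := by
    positivity
  refine le_of_mul_le_mul_right ?_ hpos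
  calc _ ≤ N0 * ((Nat.card (MonoidAlgebra F G) : ℝ) ^ k * ((lightWords F G n δ).ncard /
        (Nat.card (MonoidAlgebra F G) : ℝ) ^ n)) := by gcongr
    _ ≤ _ := key
    _ ≤ _ := mul_le_mul_of_nonneg_left hsum (Nat.cast_nonneg _)
    _ = _ := by
      have e : (Nat.card F : ℝ) ^ (((Nat.card G : ℝ) - 1) * (n * (r - g)))
          = (Nat.card F : ℝ) ^ (3 / 2 * (Nat.card G : ℝ) - n * (r - g - Nat.card G * (H - h)))
            * (Nat.card F : ℝ) ^ ((Nat.card G : ℝ) * (n * (r - g - (H - h)) - 3 / 2)) := by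
        rw [← Real.rpow_add hq0]
        congr 1
        ring
      rw [e]
      ring

/-- Success probability above the Gilbert-Varshamov bound. -/
theorem eventually_probFullRank_le {r δ : ℝ} (h0 : 0 < δ) (h1 : δ < 1 - (Nat.card F : ℝ)⁻¹)
    (hr0 : 0 < r) (hr1 : r < 1) (hr : gvBound (Nat.card F) δ < r) {k : ℕ → ℕ}
    (hk : ∀ n : ℕ, |(k n : ℝ) - r * n| ≤ 1 / 2) :
    ∀ᶠ n in atTop, probFullRank F G (k n) n δ ≤
      2 * (Nat.card (Ideal (MonoidAlgebra F G)) * Nat.card G *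
          (Nat.card F : ℝ) ^ (3 / 2 * (Nat.card G : ℝ)
            - n * ((r - gvBound (Nat.card F) δ) / 2))) := by
  have := finite_monoidAlgebra (F := F) (G := G)
  have hm0 : (0 : ℝ) < Nat.card G := by exact_mod_cast Nat.card_pos
  set g := gvBound (Nat.card F) δ with hg
  set H := entropy (Nat.card F) δ with hH
  -- Chosen so that m(H - h) = (r - g)/2: half of the gap survives the loss in the ball bound.
  set h := H - (r - g) / (2 * Nat.card G) with hh
  have hlt : h < H := by
    have : 0 < (r - g) / (2 * Nat.card G) := div_pos (by linarith) (by positivity)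
    linarith
  filter_upwards [eventually_le_ncard_light (F := F) (G := G) h0 h1 hlt,
    eventually_card_le_two_mul_card_isFullRank (F := F) (G := G) hr1 hk, eventually_gt_atTop 0,
    tendsto_natCast_atTop_atTop.eventually_gt_atTop (1 / (2 * r))] with n hL hFR hn hbig
  have hkn := hk n
  -- Here rn > 1/2, so there is a row to carry the coefficient 1.
  have hkpos : k n ≠ 0 := by
    intro hz
    rw [hz] at hkn
    have := (abs_le.1 hkn).1
    rw [div_lt_iff₀ (by positivity)] at hbig
    push_cast at this
    linarith
  obtain ⟨k', hk'⟩ := Nat.exists_eq_succ_of_ne_zero hkpos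
  rw [hk'] at hkn hFR ⊢
  have hsm := ncard_forall_vecMul_notMem_lightWords_le h0 h1 hkn hr.le hL
  rw [← hg, ← hH] at hsm
  have e : r - g - Nat.card G * (H - h) = (r - g) / 2 := by
    rw [hh]; field_simp; ring
  rw [e] at hsm
  set E := (Nat.card (Ideal (MonoidAlgebra F G)) : ℝ) * Nat.card G *
    (Nat.card F : ℝ) ^ (3 / 2 * (Nat.card G : ℝ) - n * ((r - g) / 2)) with hE
  have hE0 : 0 ≤ E := by positivity
  set FR := {A : Matrix (Fin (k' + 1)) (Fin n) (MonoidAlgebra F G) | IsFullRank A} with hFRdef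
  set good := {A : Matrix (Fin (k' + 1)) (Fin n) (MonoidAlgebra F G) |
      IsFullRank A ∧ ENNReal.ofReal δ < relDistance (code A)} with hgood
  change (good.ncard : ℝ) / (FR.ncard : ℝ) ≤ _
  have hle : (good.ncard : ℝ) ≤
      Nat.card (Matrix (Fin (k' + 1)) (Fin n) (MonoidAlgebra F G)) * E := by
    refine le_trans (Nat.cast_le.2 (Set.ncard_le_ncard ?_ (Set.toFinite _))) hsm
    rintro A ⟨hA1, hA2⟩ b
    rw [lt_relDistance_iff hn _ h0.le] at hA2
    -- Full rank makes (1,b)A a nonzero codeword, so distance above δ prevents it from being light.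
    have hne : (Fin.cons 1 b : Fin (k' + 1) → MonoidAlgebra F G) ≠ 0 := fun h =>
      one_ne_zero (α := MonoidAlgebra F G) (by simpa using congrFun h 0)
    exact not_le.2 (hA2 _ (vecMul_mem_code A _) ((isFullRank_iff_vecMul_ne_zero A).1 hA1 _ hne))
  refine div_le_of_le_mul₀ (Nat.cast_nonneg _) (by positivity) (hle.trans ?_)
  calc _ ≤ (2 * (FR.ncard : ℝ)) * E := by gcongr
    _ = _ := by ring

end

end QuasiAbelian

end

/-! ### The two regimes combined. -/

/-- For each `n`, `k n` is an integer nearest to `r n`. -/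
theorem corollary6p1 {F G : Type*} [Field F] [Finite F] [CommGroup G] [Finite G]
    (r δ : ℝ) (hr : r ∈ Set.Ioo (0 : ℝ) 1)
    (hδ : δ ∈ Set.Ioo (0 : ℝ) (1 - (Nat.card F : ℝ)⁻¹))
    (k : ℕ → ℕ) (hk : ∀ n : ℕ, |(k n : ℝ) - r * n| ≤ 1 / 2) :
    (r < QuasiAbelian.gvBound (Nat.card F) δ →
      QuasiAbelian.TendstoExponentially
        (fun n => QuasiAbelian.probFullRank F G (k n) n δ) 1) ∧
    (QuasiAbelian.gvBound (Nat.card F) δ < r →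
      QuasiAbelian.TendstoExponentially
        (fun n => QuasiAbelian.probFullRank F G (k n) n δ) 0) := by
  have hq : (1 : ℝ) < Nat.card F := by exact_mod_cast Finite.one_lt_card
  have hq0 : (0 : ℝ) < Nat.card F := by linarith
  have hlog := Real.log_pos hq
  have hp0 := fun n => QuasiAbelian.probFullRank_nonneg (F := F) (G := G) (k n) n δ
  have hp1 := fun n => QuasiAbelian.probFullRank_le_one (F := F) (G := G) (k n) n δ
  constructor
  · intro h
    refine QuasiAbelian.TendstoExponentially.of_eventually_le
      (C := Nat.card (Ideal (MonoidAlgebra F G)) * Nat.card G *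
        (Nat.card F : ℝ) ^ ((Nat.card G : ℝ) / 2))
      (mul_pos (sub_pos.2 h) hlog)
      (fun n => abs_le.2 ⟨by linarith [hp0 n], by linarith [hp1 n]⟩) ?_
    filter_upwards [Filter.eventually_gt_atTop 0] with n hn
    rw [abs_sub_comm, abs_of_nonneg (by linarith [hp1 n]), mul_assoc,
      ← QuasiAbelian.rpow_sub_mul_natCast hq0]
    exact QuasiAbelian.one_sub_probFullRank_le hn hδ.1 hδ.2 (hk n) h
  · intro h
    refine QuasiAbelian.TendstoExponentially.of_eventually_le
      (C := 2 * (Nat.card (Ideal (MonoidAlgebra F G)) * Nat.card G *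
        (Nat.card F : ℝ) ^ (3 / 2 * (Nat.card G : ℝ))))
      (mul_pos (half_pos (sub_pos.2 h)) hlog)
      (fun n => abs_le.2 ⟨by linarith [hp0 n], by linarith [hp1 n]⟩) ?_
    filter_upwards [QuasiAbelian.eventually_probFullRank_le (F := F) (G := G) hδ.1 hδ.2 hr.1 hr.2
      h hk] with n hn
    rw [sub_zero, abs_of_nonneg (hp0 n), mul_assoc, mul_assoc,
      ← QuasiAbelian.rpow_sub_mul_natCast hq0]
    exact hn
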